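/- Let $\mathfrak g$ be a finite-dimensional complex reductive Lie algebra, $\theta$ an involutive automorphism of $\mathfrak g$ with fixed subalgebra $\mathfrak k=\mathfrak g^\theta$, and $\mathfrak t\subset\mathfrak k$ a Cartan subalgebra of $\mathfrak g$. (For example: $\mathfrak g$, $\mathfrak k$, $\mathfrak t$ are the complexified Lie algebras of a reductive real algebraic group, of a maximal compact subgroup, and of a compact maximal torus contained in the latter, and $\theta$ is the complexified Cartan involution.) Let $K$ be the connected complex group with Lie algebra $\mathfrak k$, acting on $\mathfrak g$ through the group generated by all $\exp(\operatorname{ad}x)$, $x\in\mathfrak k$. Let $\Phi$ be the set of roots of $\mathfrak t$ in $\mathfrak g$, $\Phi_K=\{\alpha\in\Phi:\mathfrak g_\alpha\subset\mathfrak k\}$ the set of compact roots, $W$ the Weyl group of $\Phi$, $\Phi^+\subset\Phi$ a system of positive roots, $\Phi^-=-\Phi^+$, $\rho$ the half sum of the positive roots, $\bar C\subset\mathfrak t^\vee$ the closed positive Weyl chamber (all $\mu$ whose pairing with each positive coroot is real and $\ge 0$), and $\mathfrak n=\bigoplus_{\alpha\in\Phi^+}\mathfrak g_{-\alpha}$.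 For $w\in W$ let $l(w)$ be the length of $w$ with respect to the simple reflections, and let $l_K(w)=\#(\Phi^+\cap w\Phi^-\cap\Phi_K)$. Write $x\to y$ if $x=s_\alpha y$ for some $\alpha\in\Phi$ and $l(x)=l(y)+1$, and $x<y$ if there is a chain $x\to x_1\to\dots\to x_n\to y$ (possibly with $n=0$, that is, $x\to y$). Let $Q$ be a $K$-orbit (for instance a closed one) on the variety of Borel subalgebras of $\mathfrak g$, let $\lambda\in\mathfrak t^\vee$ and $c\in\mathbb Z$, and put $$A=\{w\in W: w(\mathfrak n\oplus\mathfrak t)\in Q\},\qquad D=\{w\in W:\lambda+\rho\in w\bar C\},$$ $$\mathcal V=\mathcal V(A,D,c)=\{w\in A\cap D:\ l(w)=l_K(w)+c\}.$$ **Theorem.** (1) $\mathcal V$ satisfies $(\star)$: if $w_1,w_2\in\mathcal V$ and $l(w_1)=l(w_2)+2$, then $\{w\in\mathcal V: w_1<w<w_2\}$ is empty or has exactly two elements. (2) Consequently $\mathcal V$ carries a cochain complex. Let $C^q\mathcal V$ be the complex vector space with basis $\{v\in\mathcal V:l(v)=q\}$, and $C^\bullet\mathcal V=\bigoplus_q C^q\mathcal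 V$. There are coefficients $s(x,y)$, $x,y\in\mathcal V$, with $s(x,y)\in\{1,-1\}$ if $y\to x$, with $s(x,y)=0$ otherwise, and with $s(x,w)s(w,y)+s(x,w')s(w',y)=0$ whenever $w\ne w'$ in $\mathcal V$ satisfy $y\to w\to x$ and $y\to w'\to x$. For every such choice of coefficients, the linear map given by $dx=\sum_{y\in\mathcal V}s(x,y)\,y$ maps $C^q\mathcal V$ to $C^{q+1}\mathcal V$ for all $q$, and $d^2=0$. -/

import Mathlib

/-!
Setting.  `𝔤` is a finite-dimensional complex reductive Lie algebra: it is the direct sum of a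
semisimple ideal `𝔰` and of its centre.  `H` is a Cartan subalgebra of `𝔰`, so that
`𝔱 = H ⊕ (centre)` is a Cartan subalgebra of `𝔤`; the roots of `𝔱` on `𝔤` vanish on the centre, and
are the roots of `H` on `𝔰`.  A choice of simple roots is a base `b` of the root system.
`θ` is an involutive automorphism of `𝔤` (the complexified Cartan involution of a real reductive
group with maximal compact subgroup `K`), with fixed subalgebra `𝔨`.
-/

namespace CompactWeyl

open Module LieAlgebra

noncomputable section

/-! ### The Weyl group, its lengths, and the Bruhat order -/

section Weyl

variable {𝔰 : Type*} [LieRing 𝔰] [LieAlgebra ℂ 𝔰] [FiniteDimensional ℂ 𝔰]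
  [LieAlgebra.IsKilling ℂ 𝔰]

/-- The Weyl group `W` of the root system of `H`. -/
abbrev Weyl (H : LieSubalgebra ℂ 𝔰) [H.IsCartanSubalgebra] : Type _ :=
  (IsKilling.rootSystem H).weylGroup

theorem finite_weyl (H : LieSubalgebra ℂ 𝔰) [H.IsCartanSubalgebra] : Finite (Weyl H) := by
  refine Finite.of_injective (fun w : Weyl H => (IsKilling.rootSystem H).weylGroupToPerm w) ?_
  intro g h hgh
  have key : ∀ m : Dual ℂ H, g • m = h • m := by
    intro m
    have hm : m ∈ Submodule.span ℂ (Set.range (IsKilling.rootSystem H).root) := by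
      rw [RootPairing.IsRootSystem.span_root_eq_top]; trivial
    induction hm using Submodule.span_induction with
    | mem x hx =>
      obtain ⟨i, rfl⟩ := hx
      rw [RootPairing.weylGroup_apply_root, RootPairing.weylGroup_apply_root]
      exact congrArg _ (congrArg (fun e : Equiv.Perm _ => e i) hgh)
    | zero => simp
    | add x y _ _ hx hy => simp [smul_add, hx, hy]
    | smul a x _ hx =>
      have e1 : g • (a • x) = a • (g • x) := smul_comm g.1 a x
      have e2 : h • (a • x) = a • (h • x) := smul_comm h.1 a x
      rw [e1, e2, hx]
  apply Subtype.ext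
  apply RootPairing.Equiv.weightHom_injective (IsKilling.rootSystem H)
  ext m : 1
  exact key m

instance (H : LieSubalgebra ℂ 𝔰) [H.IsCartanSubalgebra] : Finite (Weyl H) := finite_weyl H

variable {H : LieSubalgebra ℂ 𝔰} [H.IsCartanSubalgebra]

/-- The reflection `s_α`, as an element of the Weyl group. -/
def refl (α : H.root) : Weyl H := RootPairing.weylGroup.ofIdx (IsKilling.rootSystem H) α

/-- The Bruhat length `l(w)`: the least number of simple reflections whose product is `w`. -/
def length (b : (IsKilling.rootSystem H).Base) (w : Weyl H) : ℕ :=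
  sInf {n | ∃ L : List H.root, (∀ α ∈ L, α ∈ b.support) ∧ (L.map refl).prod = w ∧ L.length = n}

/-- `x ⟶ y`: one has `x = s_α y` for some root `α`, and `l(x) = l(y) + 1`. -/
def Arrow (b : (IsKilling.rootSystem H).Base) (x y : Weyl H) : Prop :=
  (∃ α : H.root, x = refl α * y) ∧ length b x = length b y + 1

/-- The Bruhat order in the direction of the arrows: `x ⟶ x₁ ⟶ ⋯ ⟶ xₙ ⟶ y` for some `xᵢ ∈ W`
(so that `x` is the longer element). -/
def BruhatLT (b : (IsKilling.rootSystem H).Base) : Weyl H → Weyl H → Prop :=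
  Relation.TransGen (Arrow b)

/-- Condition (⋆) for a subset `V` of the Weyl group: between two elements of `V` whose lengths
differ by `2` there lie either no elements of `V` or exactly two. -/
def Star (b : (IsKilling.rootSystem H).Base) (V : Set (Weyl H)) : Prop :=
  ∀ w₁ ∈ V, ∀ w₂ ∈ V, length b w₁ = length b w₂ + 2 →
    {w ∈ V | BruhatLT b w₁ w ∧ BruhatLT b w w₂} = ∅ ∨
    {w ∈ V | BruhatLT b w₁ w ∧ BruhatLT b w w₂}.ncard = 2

/-! ### The complex `C^• V` -/

/-- Admissible matrix coefficients `s_V(x, y)` for a differential that raises the length by one: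
they are `±1` along the edges of the induced graph on `V`, zero elsewhere, and any two distinct
paths of two edges in `V` with the same end points cancel. -/
structure IsCoeff (b : (IsKilling.rootSystem H).Base) (V : Set (Weyl H)) (s : V → V → ℂ) :
    Prop where
  edge : ∀ x y : V, Arrow b y.1 x.1 → s x y = 1 ∨ s x y = -1
  non_edge : ∀ x y : V, ¬ Arrow b y.1 x.1 → s x y = 0
  square : ∀ x w w' y : V, w ≠ w' → Arrow b w.1 x.1 → Arrow b y.1 w.1 →
    Arrow b w'.1 x.1 → Arrow b y.1 w'.1 → s x w * s w y + s x w' * s w' y = 0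

/-- The graded piece `C^q V`, spanned by the elements of `V` of length `q`, of the free vector
space on `V`. -/
def cochains (b : (IsKilling.rootSystem H).Base) (V : Set (Weyl H)) (q : ℤ) :
    Submodule ℂ (V →₀ ℂ) :=
  Submodule.span ℂ {f | ∃ v : V, (length b v.1 : ℤ) = q ∧ f = Finsupp.single v 1}

/-- The differential: `d x = ∑_{y ∈ V} s(x, y) y` for `x ∈ V`. -/
def differential (V : Set (Weyl H)) (s : V → V → ℂ) : (V →₀ ℂ) →ₗ[ℂ] (V →₀ ℂ) :=
  Finsupp.linearCombination ℂ fun x : V => Finsupp.equivFunOnFinite.symm (s x)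

/-- The closed positive Weyl chamber, in the dual of `H`. -/
def closedChamber (b : (IsKilling.rootSystem H).Base) : Set (Dual ℂ H) :=
  {μ | ∀ α : H.root, b.IsPos α →
    0 ≤ (μ ((IsKilling.rootSystem H).coroot α)).re ∧
      (μ ((IsKilling.rootSystem H).coroot α)).im = 0}

open scoped Classical in
/-- The half sum `ρ` of the positive roots, in the dual of `H`. -/
def rho (b : (IsKilling.rootSystem H).Base) : Dual ℂ H :=
  (2⁻¹ : ℂ) • ∑ α : H.root with b.IsPos α, (IsKilling.rootSystem H).root α

end Weyl

/-! ### The reductive Lie algebra, the group `K`, and the subsets `A` and `D` of `W` -/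

section Reductive

variable {𝔤 : Type*} [LieRing 𝔤] [LieAlgebra ℂ 𝔤]

/-- The Cartan subalgebra `𝔱 = H ⊕ (centre)` of `𝔤`. -/
def cartan (𝔰 : LieIdeal ℂ 𝔤) (H : LieSubalgebra ℂ 𝔰) : Submodule ℂ 𝔤 :=
  H.toSubmodule.map (𝔰.toSubmodule.subtype) ⊔ (LieAlgebra.center ℂ 𝔤).toSubmodule

/-- The inclusion of `H` into `𝔱`. -/
def toCartan (𝔰 : LieIdeal ℂ 𝔤) (H : LieSubalgebra ℂ 𝔰) : H →ₗ[ℂ] cartan 𝔰 H :=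
  (𝔰.toSubmodule.subtype ∘ₗ H.toSubmodule.subtype).codRestrict (cartan 𝔰 H) fun h =>
    Submodule.mem_sup_left ⟨h.1, h.2, rfl⟩

/-- The subalgebra `𝔨` of fixed points of `θ`. -/
def fixedSubalgebra (θ : 𝔤 ≃ₗ⁅ℂ⁆ 𝔤) : LieSubalgebra ℂ 𝔤 where
  carrier := {x | θ x = x}
  add_mem' := fun {x y} (hx : θ x = x) (hy : θ y = y) =>
    show θ (x + y) = x + y by rw [map_add, hx, hy]
  zero_mem' := map_zero θ
  smul_mem' := fun a x (hx : θ x = x) => show θ (a • x) = a • x by rw [map_smul, hx]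
  lie_mem' := fun {x y} (hx : θ x = x) (hy : θ y = y) =>
    show θ ⁅x, y⁆ = ⁅x, y⁆ by rw [LieEquiv.map_lie, hx, hy]

/-- `u = exp(ad x)`: the series `∑ₙ (ad x)ⁿ y / n!` converges to `u y` for every `y`.  Convergence
in the finite-dimensional space `𝔤` is tested against all linear functionals. -/
def IsExpAd (x : 𝔤) (u : 𝔤 ≃ₗ[ℂ] 𝔤) : Prop :=
  ∀ (y : 𝔤) (f : Dual ℂ 𝔤),
    HasSum (fun n : ℕ => (n.factorial : ℂ)⁻¹ * f (((LieAlgebra.ad ℂ 𝔤 x) ^ n) y)) (f (u y))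

/-- The image in `GL(𝔤)` of the connected complex group `K` with Lie algebra `𝔨`: the group
generated by the `exp(ad x)` with `x ∈ 𝔨`. -/
def groupK (θ : 𝔤 ≃ₗ⁅ℂ⁆ 𝔤) : Subgroup (𝔤 ≃ₗ[ℂ] 𝔤) :=
  Subgroup.closure {u | ∃ x ∈ fixedSubalgebra θ, IsExpAd x u}

/-- The flag variety of `𝔤`: the set of (underlying subspaces of) Borel subalgebras, that is, of
maximal solvable subalgebras. -/
def flagVariety (𝔤 : Type*) [LieRing 𝔤] [LieAlgebra ℂ 𝔤] : Set (Submodule ℂ 𝔤) :=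
  {B | ∃ 𝔟 : LieSubalgebra ℂ 𝔤,
    Maximal (fun 𝔠 : LieSubalgebra ℂ 𝔤 => LieAlgebra.IsSolvable 𝔠) 𝔟 ∧ 𝔟.toSubmodule = B}

/-- `Q` is an orbit of the group `K` on the flag variety. -/
def IsOrbit (θ : 𝔤 ≃ₗ⁅ℂ⁆ 𝔤) (Q : Set (Submodule ℂ 𝔤)) : Prop :=
  ∃ B ∈ flagVariety 𝔤, Q = {B' | ∃ u ∈ groupK θ, B' = B.map (u : 𝔤 →ₗ[ℂ] 𝔤)}

variable [FiniteDimensional ℂ 𝔤]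
  {𝔰 : LieIdeal ℂ 𝔤} [LieAlgebra.IsKilling ℂ 𝔰] {H : LieSubalgebra ℂ 𝔰} [H.IsCartanSubalgebra]

/-- The root space `𝔤_α`, as a subspace of `𝔤`. -/
def rootSubspace (α : H.root) : Submodule ℂ 𝔤 :=
  (LieAlgebra.rootSpace H α.1).toSubmodule.map
    (𝔰.toSubmodule.subtype)

/-- `α` is a compact root: its root space is contained in `𝔨`. -/
def IsCompactRoot (θ : 𝔤 ≃ₗ⁅ℂ⁆ 𝔤) (α : H.root) : Prop :=
  rootSubspace α ≤ (fixedSubalgebra θ).toSubmodule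

/-- The compact length `l_K(w) = #(Φ⁺ ∩ wΦ⁻ ∩ Φ_K)`. -/
def compactLength (b : (IsKilling.rootSystem H).Base) (θ : 𝔤 ≃ₗ⁅ℂ⁆ 𝔤) (w : Weyl H) : ℕ :=
  {α : H.root | b.IsPos α ∧ (∃ β : H.root, ¬ b.IsPos β ∧ α = w • β) ∧ IsCompactRoot θ α}.ncard

/-- The Borel subalgebra `w(𝔫 ⊕ 𝔱)`, where `𝔫` is the sum of the negative root spaces. -/
def borel (b : (IsKilling.rootSystem H).Base) (w : Weyl H) : Submodule ℂ 𝔤 :=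
  cartan 𝔰 H ⊔ ⨆ α : H.root, ⨆ _ : ¬ b.IsPos α, rootSubspace (w • α)

/-- `A = {w ∈ W | w(𝔫 ⊕ 𝔱) ∈ Q}`. -/
def setA (b : (IsKilling.rootSystem H).Base) (Q : Set (Submodule ℂ 𝔤)) : Set (Weyl H) :=
  {w | borel b w ∈ Q}

/-- `D = {w ∈ W | λ + ρ ∈ w C̄}`.  The Weyl group fixes, and the chamber does not constrain, the
restriction of a weight to the centre, so the condition is read on `H`. -/
def setD (b : (IsKilling.rootSystem H).Base) (lam : Dual ℂ (cartan 𝔰 H)) : Set (Weyl H) :=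
  {w | ∃ ν ∈ closedChamber b, lam ∘ₗ toCartan 𝔰 H + rho b = w • ν}

/-- `𝒱(A, D, c) = {w ∈ A ∩ D | l(w) = l_K(w) + c}`. -/
def setV (b : (IsKilling.rootSystem H).Base) (θ : 𝔤 ≃ₗ⁅ℂ⁆ 𝔤) (A D : Set (Weyl H)) (c : ℤ) :
    Set (Weyl H) :=
  {w ∈ A ∩ D | (length b w : ℤ) = compactLength b θ w + c}

end Reductive

end

end CompactWeyl

set_option linter.unusedSectionVars false

namespace CompactWeyl

open Module

/-! ### Reflection subsystems of a root system -/

section Reflections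

variable {ι R M N : Type*} [Field R] [CharZero R] [AddCommGroup M] [Module R M]
  [AddCommGroup N] [Module R N] {P : RootPairing ι R M N}

/-! Suppose `x → m → z` is a path in `𝒱`, with `x = s_δ m` and `m = s_γ z`. Everything rests on
showing that the second midpoint of the interval between `x` and `z` in `W` also lies in `𝒱`
(`hasSquares_setV`). Then (⋆) holds, and each matrix entry of `d²` is either zero or the sum over
one anticommuting square.

Membership in `A` forces `δ` and `γ` to be compact: if `w` and `s_α w` give Borel subalgebras in one
`K`-orbit, then `s_α` lies in the group generated by the compact reflections, and so `α` is compact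
(`isCompactRoot_of_mem_setA`). Membership in `D` forces `μ = λ + ρ` to be orthogonal to `δ` and `γ`.
As `l - l_K` is constant on `𝒱`, the element `m` is also a midpoint for the Bruhat order of the
compact roots. Length-two intervals of that order have two midpoints (`ncard_between`, proved for
every set of roots closed under its own reflections), so there is another one, `m' = s_γ' z` with `x
= s_δ' m'` and `γ'` compact. A reflection that raises `l_K` raises `l` too, so `m'` is a midpoint in
`W` (`exists_other_midpoint`). It lies in `A` because `γ'` is compact, and in `D` because `s_δ' s_γ'
= s_δ s_γ ≠ 1` fixes `μ`, whence `μ ⊥ γ'`.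

The orbit statement needs that Borel subalgebras containing `𝔱` which are `K`-conjugate and contain
the same compact root spaces are equal (`eq_of_map_borel_eq`). The determinant of `𝔤/B` is a
multilinear form on `𝔤` with kernel `B`. It is an extremal weight vector of the `K`-module that it
generates, and so is its translate with kernel `B'`. Uniqueness of the extremal line makes the two
forms proportional.

Coefficients exist because the whole Bruhat graph has signs for which every square anticommutes
(`exists_sign`); these restrict to any subset. -/

variable (P) in
/-- The reflection in the root of index `i`, as an element of the Weyl group. -/
abbrev reflW (i : ι) : P.weylGroup := RootPairing.weylGroup.ofIdx P i

theorem reflW_smul (i j : ι) : reflW P i • j = P.reflectionPerm i j := rfl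

theorem root_smul (w : P.weylGroup) (i : ι) : P.root (w • i) = w • P.root i :=
  (RootPairing.weylGroup_apply_root P w i).symm

theorem reflW_smul_weight (i : ι) (m : M) : reflW P i • m = P.reflection i m := rfl

theorem weyl_smul_smul (w : P.weylGroup) (a : R) (m : M) : w • (a • m) = a • (w • m) :=
  smul_comm w.1 a m

theorem weyl_smul_sub (w : P.weylGroup) (m m' : M) : w • (m - m') = w • m - w • m' :=
  smul_sub w m m'

theorem weyl_ext {g h : P.weylGroup} (e : ∀ m : M, g • m = h • m) : g = h := by
  apply Subtype.ext
  apply RootPairing.Equiv.weightHom_injective P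
  ext m : 1
  exact e m

/-- The Weyl group acts on coroots in a way compatible with the pairing. -/
theorem toLinearMap_smul_coroot (w : P.weylGroup) (m : M) (i : ι) :
    P.toLinearMap (w • m) (P.coroot (w • i)) = P.toLinearMap m (P.coroot i) := by
  have h2 := congr_fun w.1.coroot_coweightMap (w • i)
  have h3 := RootPairing.Hom.weight_coweight_transpose_apply P P (P.coroot (w • i)) w.1.toHom
  have h4 : P.coroot i = w.1.coweightMap (P.coroot (w • i)) := by
    have : w.1.indexEquiv.symm (w • i) = i := w.1.indexEquiv.symm_apply_apply i
    simp only [Function.comp_apply, this] at h2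
    exact h2.symm
  rw [h4]
  have h5 := LinearMap.congr_fun h3 m
  exact h5

theorem reflW_conj (w : P.weylGroup) (i : ι) : reflW P (w • i) = w * reflW P i * w⁻¹ := by
  apply weyl_ext
  intro m
  obtain ⟨m, rfl⟩ : ∃ m', m = w • m' := ⟨w⁻¹ • m, by simp⟩
  rw [mul_smul, inv_smul_smul, mul_smul, reflW_smul_weight, reflW_smul_weight,
    RootPairing.reflection_apply, RootPairing.reflection_apply, weyl_smul_sub, weyl_smul_smul,
    root_smul]
  congr 2
  simpa using toLinearMap_smul_coroot w m i

theorem reflW_mul_self (i : ι) : reflW P i * reflW P i = 1 := by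
  apply weyl_ext
  intro m
  rw [mul_smul, reflW_smul_weight, reflW_smul_weight, one_smul]
  simp

theorem reflW_inv (i : ι) : (reflW P i)⁻¹ = reflW P i := inv_eq_of_mul_eq_one_left (reflW_mul_self i)

@[simp] theorem reflW_mul_cancel (i : ι) (w : P.weylGroup) : reflW P i * (reflW P i * w) = w := by
  rw [← mul_assoc, reflW_mul_self, one_mul]

@[simp] theorem reflW_smul_cancel (i j : ι) : reflW P i • (reflW P i • j) = j := by
  rw [smul_smul, reflW_mul_self, one_smul]

theorem root_reflW_self (i : ι) : P.root (reflW P i • i) = -P.root i := by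
  rw [reflW_smul, RootPairing.root_reflectionPerm, RootPairing.reflection_apply_self]

theorem reflW_neg (i : ι) : reflW P (reflW P i • i) = reflW P i := by
  rw [reflW_conj, reflW_mul_self, one_mul, reflW_inv]

theorem smul_neg (w : P.weylGroup) (i : ι) : w • (reflW P i • i) = reflW P (w • i) • (w • i) := by
  rw [reflW_conj]
  simp only [mul_smul, inv_smul_smul]

theorem reflW_mul_inv_smul (i j : ι) (w : P.weylGroup) :
    (reflW P i * w)⁻¹ • j = w⁻¹ • (reflW P i • j) := by
  rw [mul_inv_rev, mul_smul, reflW_inv]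

theorem neg_inj' {i j : ι} (h : reflW P i • i = reflW P j • j) : i = j := by
  have : P.root (reflW P i • i) = P.root (reflW P j • j) := by rw [h]
  rw [root_reflW_self, root_reflW_self] at this
  exact P.root.injective (neg_injective this)

variable [P.IsCrystallographic]

theorem root_smul_reflW (w : P.weylGroup) (i j : ι) :
    P.root (w • (reflW P i • j)) =
      P.root (w • j) + (-P.pairingIn ℤ j i) • P.root (w • i) := by
  rw [root_smul w (reflW P i • j), root_smul w j, root_smul w i, reflW_smul,
    RootPairing.root_reflectionPerm,
    RootPairing.reflection_apply_root' ℤ, weyl_smul_sub, neg_smul, sub_eq_add_neg]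
  congr 2
  rw [← Int.cast_smul_eq_zsmul R, weyl_smul_smul, Int.cast_smul_eq_zsmul]

variable (b : P.Base)

theorem height_smul_reflW (w : P.weylGroup) (i j : ι) :
    b.height (w • (reflW P i • j)) =
      b.height (w • j) - P.pairingIn ℤ j i * b.height (w • i) := by
  rw [b.height_add_zsmul (root_smul_reflW w i j), smul_eq_mul]
  ring

theorem height_reflW (i j : ι) :
    b.height (reflW P i • j) = b.height j - P.pairingIn ℤ j i * b.height i := by
  simpa using height_smul_reflW b 1 i j

theorem height_neg (i : ι) : b.height (reflW P i • i) = -b.height i :=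
  b.height_reflectionPerm_self i

theorem isPos_neg (i : ι) : b.IsPos (reflW P i • i) ↔ ¬ b.IsPos i := by
  exact RootPairing.Base.IsPos.neg_iff_not b i

theorem isPos_smul_neg (w : P.weylGroup) (i : ι) :
    b.IsPos (w • (reflW P i • i)) ↔ ¬ b.IsPos (w • i) := by
  rw [smul_neg, isPos_neg]

variable (P) in
/-- A set of roots is closed if it is stable under the reflections in its members. -/
def IsReflClosed (Ψ : Set ι) : Prop := ∀ i ∈ Ψ, ∀ j ∈ Ψ, reflW P i • j ∈ Ψ

/-- The positive roots in `Ψ` which are made negative by `w⁻¹`. -/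
def inversions (Ψ : Set ι) (w : P.weylGroup) : Set ι :=
  {i | i ∈ Ψ ∧ b.IsPos i ∧ ¬ b.IsPos (w⁻¹ • i)}

/-- The number of positive roots in `Ψ` which are made negative by `w⁻¹`. -/
noncomputable def invCount (Ψ : Set ι) (w : P.weylGroup) : ℕ := (inversions b Ψ w).ncard

variable {b}

variable {Ψ : Set ι} [Finite ι]

/-- The map `φ` injects the inversions of `w` into those of `s_i w` other than `i`: it reflects `j`
if `s_i j` is positive and keeps `j` otherwise. In the second case `j` pairs positively with the
coroot of `i`, so `w⁻¹ s_i j` differs from the nonpositive `w⁻¹ j` by a negative multiple of the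
positive `w⁻¹ i`. -/
theorem invCount_lt (hΨ : IsReflClosed P Ψ) {i : ι} (hi : i ∈ Ψ) (hpos : b.IsPos i)
    {w : P.weylGroup} (hw : b.IsPos (w⁻¹ • i)) :
    invCount b Ψ w < invCount b Ψ (reflW P i * w) := by
  classical
  have aux : ∀ j, b.IsPos j → ¬ b.IsPos (reflW P i • j) → ¬ b.IsPos (w⁻¹ • j) →
      ¬ b.IsPos (w⁻¹ • (reflW P i • j)) := by
    intro j h1 h2 h3
    rw [RootPairing.Base.isPos_iff] at h1 h2 h3 hpos hw ⊢
    rw [height_reflW] at h2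
    rw [height_smul_reflW]
    have hp : 0 < P.pairingIn ℤ j i := by
      by_contra hp
      push Not at hp
      nlinarith
    nlinarith
  let φ : ι → ι := fun j => if b.IsPos (reflW P i • j) then reflW P i • j else j
  have hmem : ∀ j ∈ inversions b Ψ w, φ j ∈ inversions b Ψ (reflW P i * w) \ {i} := by
    rintro j ⟨h1, h2, h3⟩
    by_cases h : b.IsPos (reflW P i • j)
    · simp only [φ, if_pos h]
      refine ⟨⟨hΨ i hi j h1, h, ?_⟩, ?_⟩
      · rwa [reflW_mul_inv_smul, reflW_smul_cancel]
      · rintro (h' : _ = i)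
        have h4 : j = reflW P i • i := by rw [← reflW_smul_cancel (P := P) i j, h']
        rw [h4, isPos_neg] at h2
        exact h2 hpos
    · simp only [φ, if_neg h]
      refine ⟨⟨h1, h2, ?_⟩, ?_⟩
      · rw [reflW_mul_inv_smul]
        exact aux j h2 h h3
      · rintro (rfl : _ = i)
        exact h3 hw
  have hinj : Set.InjOn φ (inversions b Ψ w) := by
    rintro j ⟨h1, h2, h3⟩ k ⟨k1, k2, k3⟩ h
    by_cases hj : b.IsPos (reflW P i • j) <;> by_cases hk : b.IsPos (reflW P i • k) <;>
      simp only [φ, if_pos, if_neg, hj, hk, not_false_eq_true] at h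
    · exact MulAction.injective _ h
    · rw [← h, reflW_smul_cancel] at hk
      exact absurd h2 hk
    · rw [h, reflW_smul_cancel] at hj
      exact absurd k2 hj
    · exact h
  have h1 : invCount b Ψ w ≤ (inversions b Ψ (reflW P i * w) \ {i}).ncard :=
    Set.ncard_le_ncard_of_injOn φ hmem hinj (Set.toFinite _)
  have h2 : i ∈ inversions b Ψ (reflW P i * w) := by
    refine ⟨hi, hpos, ?_⟩
    rw [reflW_mul_inv_smul, isPos_smul_neg]
    exact not_not.mpr hw
  exact lt_of_le_of_lt h1 (Set.ncard_sdiff_singleton_lt_of_mem h2 (Set.toFinite _))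

theorem invCount_gt (hΨ : IsReflClosed P Ψ) {i : ι} (hi : i ∈ Ψ) (hpos : b.IsPos i)
    {w : P.weylGroup} (hw : ¬ b.IsPos (w⁻¹ • i)) :
    invCount b Ψ (reflW P i * w) < invCount b Ψ w := by
  have := invCount_lt hΨ hi hpos (w := reflW P i * w)
    (by rw [reflW_mul_inv_smul, isPos_smul_neg]; exact hw)
  rwa [reflW_mul_cancel] at this

theorem isPos_inv_smul_iff (hΨ : IsReflClosed P Ψ) {i : ι} (hi : i ∈ Ψ) (hpos : b.IsPos i)
    {w : P.weylGroup} :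
    b.IsPos (w⁻¹ • i) ↔ invCount b Ψ w < invCount b Ψ (reflW P i * w) := by
  refine ⟨invCount_lt hΨ hi hpos, fun h => ?_⟩
  by_contra hn
  exact lt_asymm h (invCount_gt hΨ hi hpos hn)

variable (b) in
/-- The simple roots of the positive system induced on `Ψ`. -/
def IsSimpleIn (Ψ : Set ι) (a : ι) : Prop :=
  a ∈ Ψ ∧ b.IsPos a ∧ ∀ j ∈ Ψ, b.IsPos j → j ≠ a → b.IsPos (reflW P a • j)

/-- A simple reflection of `Ψ` keeps the other positive roots of `Ψ` positive, so it carries the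
inversions of `s_a w` other than `a` into those of `w`. -/
theorem invCount_reflW_of_isPos (hΨ : IsReflClosed P Ψ) {a : ι} (ha : IsSimpleIn b Ψ a)
    {w : P.weylGroup} (hw : b.IsPos (w⁻¹ • a)) :
    invCount b Ψ (reflW P a * w) = invCount b Ψ w + 1 := by
  refine le_antisymm ?_ (invCount_lt hΨ ha.1 ha.2.1 hw)
  have h2 : a ∈ inversions b Ψ (reflW P a * w) := by
    refine ⟨ha.1, ha.2.1, ?_⟩
    rw [reflW_mul_inv_smul, isPos_smul_neg]
    exact not_not.mpr hw
  rw [invCount, ← Set.ncard_sdiff_singleton_add_one h2 (Set.toFinite _)]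
  refine Nat.succ_le_succ ?_
  refine Set.ncard_le_ncard_of_injOn (fun j => reflW P a • j) ?_ (MulAction.injective _).injOn
    (Set.toFinite _)
  rintro j ⟨⟨h1, h2, h3⟩, h4⟩
  exact ⟨hΨ _ ha.1 _ h1, ha.2.2 j h1 h2 h4, by rwa [reflW_mul_inv_smul] at h3⟩

theorem invCount_reflW_of_not_isPos (hΨ : IsReflClosed P Ψ) {a : ι} (ha : IsSimpleIn b Ψ a)
    {w : P.weylGroup} (hw : ¬ b.IsPos (w⁻¹ • a)) :
    invCount b Ψ w = invCount b Ψ (reflW P a * w) + 1 := by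
  have := invCount_reflW_of_isPos hΨ ha (w := reflW P a * w)
    (by rw [reflW_mul_inv_smul, isPos_smul_neg]; exact hw)
  rwa [reflW_mul_cancel] at this

variable [P.IsReduced]

/-- One of the two pairing integers is 1, so `i - j` is either `s_j i` or `-s_i j`. Both are
obtained by reflections inside `Ψ`. -/
theorem sub_mem_of_pairingIn_pos (hΨ : IsReflClosed P Ψ) {i j : ι} (hi : i ∈ Ψ) (hj : j ∈ Ψ)
    (hij : i ≠ j) (hp : 0 < P.pairingIn ℤ i j) : ∃ k ∈ Ψ, P.root k = P.root i - P.root j := by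
  have h := P.pairingIn_pairingIn_mem_set_of_isCrystal_of_isRed' i j
    (fun h => hij (P.root.injective h))
    (fun h => by
      have h' : i = reflW P j • j := P.root.injective (by rw [h, root_reflW_self])
      rw [h', reflW_smul, RootPairing.pairingIn_reflectionPerm_self_left] at hp
      simp at hp
      )
  have : P.pairingIn ℤ i j = 1 ∨ P.pairingIn ℤ j i = 1 := by
    simp only [Set.mem_insert_iff, Set.mem_singleton_iff, Prod.mk.injEq] at h
    omega
  rcases this with h | h
  · refine ⟨reflW P j • i, hΨ _ hj _ hi, ?_⟩
    have := root_smul_reflW (1 : P.weylGroup) j i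
    rw [h] at this
    simpa [sub_eq_add_neg] using this
  · have h1 := hΨ _ hi _ hj
    refine ⟨reflW P (reflW P i • j) • (reflW P i • j), hΨ _ h1 _ h1, ?_⟩
    have := root_smul_reflW (1 : P.weylGroup) i j
    rw [h] at this
    rw [root_reflW_self]
    simp only [one_smul, neg_smul] at this
    rw [this]
    abel

/-- Every root of `Ψ` which becomes negative under `w⁻¹` leads to a simple such root. -/
theorem exists_isSimpleIn (hΨ : IsReflClosed P Ψ) {w : P.weylGroup} {i : ι}
    (hi : i ∈ Ψ) (hpos : b.IsPos i) (hw : ¬ b.IsPos (w⁻¹ • i)) :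
    ∃ a, IsSimpleIn b Ψ a ∧ ¬ b.IsPos (w⁻¹ • a) := by
  induction hn : (b.height i).toNat using Nat.strong_induction_on generalizing i with
  | _ n ih =>
  by_cases hs : IsSimpleIn b Ψ i
  · exact ⟨i, hs, hw⟩
  -- A positive root of `Ψ` that is not simple is a sum of two positive roots of `Ψ`. One summand
  -- must become negative under `w⁻¹`, and both have smaller height than `i`.
  have hdec : ∃ j ∈ Ψ, ∃ k ∈ Ψ, b.IsPos j ∧ b.IsPos k ∧ P.root i = P.root j + P.root k := by
    simp only [IsSimpleIn, hi, hpos, true_and, not_forall] at hs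
    obtain ⟨j, hj, hjpos, hji, hneg⟩ := hs
    have hp : 0 < P.pairingIn ℤ j i := by
      rw [RootPairing.Base.isPos_iff] at hpos hjpos hneg
      rw [height_reflW] at hneg
      by_contra hp
      push Not at hp
      nlinarith
    have key : ∀ j ∈ Ψ, j ≠ i → b.IsPos j → 0 < P.pairingIn ℤ j i → b.height j < b.height i →
        ∃ j ∈ Ψ, ∃ k ∈ Ψ, b.IsPos j ∧ b.IsPos k ∧ P.root i = P.root j + P.root k := by
      intro j hj hji hjpos hp hlt
      obtain ⟨k, hk, hkr⟩ := sub_mem_of_pairingIn_pos hΨ hi hj (Ne.symm hji)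
        ((P.zero_lt_pairingIn_iff' ℤ).mp hp)
      refine ⟨j, hj, k, hk, hjpos, ?_, by rw [hkr]; abel⟩
      rw [RootPairing.Base.isPos_iff, b.height_sub hkr]
      omega
    rcases lt_or_ge (b.height j) (b.height i) with hlt | hge
    · exact key j hj hji hjpos hp hlt
    -- When `j` is too high to be subtracted from `i`, its mirror image `k = -s_i j` is tried; it
    -- has the same pairing with `i`.
    set k := reflW P (reflW P i • j) • (reflW P i • j) with hk
    have hkh : b.height k = P.pairingIn ℤ j i * b.height i - b.height j := by
      rw [hk, height_neg, height_reflW]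
      ring
    have hkp : P.pairingIn ℤ k i = P.pairingIn ℤ j i := by
      have h1 : reflW P i • k = reflW P j • j := by
        rw [hk, smul_neg, reflW_smul_cancel]
      have h2 := height_reflW b i k
      rw [h1, height_neg, hkh] at h2
      have : (P.pairingIn ℤ k i - P.pairingIn ℤ j i) * b.height i = 0 := by linarith
      rcases mul_eq_zero.mp this with h | h
      · linarith
      · exact absurd h (b.height_ne_zero i)
    have hkΨ : k ∈ Ψ := hΨ _ (hΨ _ hi _ hj) _ (hΨ _ hi _ hj)
    have hkpos : b.IsPos k := by rw [hk, isPos_neg]; exact hneg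
    have hki : k ≠ i := by
      intro h
      have h1 : reflW P i • k = reflW P j • j := by
        rw [hk, smul_neg, reflW_smul_cancel]
      rw [h] at h1
      exact hji (neg_inj' h1).symm
    rcases lt_or_ge (b.height k) (b.height i) with hlt | hge'
    · exact key k hkΨ hki hkpos (by rw [hkp]; exact hp) hlt
    -- Now `j` and `k` are both at least as high as `i`, so `l = j - i` and `l' = k - i` are
    -- positive. Their heights add up to `(p - 2)` times that of `i`, where `p` is the pairing.
    -- Hence `p = 3`, as in type `G₂`, and `l + l' = i`.
    obtain ⟨l, hl, hlr⟩ := sub_mem_of_pairingIn_pos hΨ hj hi hji hp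
    obtain ⟨l', hl', hlr'⟩ := sub_mem_of_pairingIn_pos hΨ hkΨ hi hki (by rw [hkp]; exact hp)
    have hset := P.pairingIn_pairingIn_mem_set_of_isCrystal_of_isRed' j i
      (fun h => hji (P.root.injective h))
      (fun h => by
        have h' : j = reflW P i • i := P.root.injective (by rw [h, root_reflW_self])
        rw [h', isPos_neg] at hjpos
        exact hjpos hpos)
    have hlh : b.height l = b.height j - b.height i := b.height_sub hlr
    have hlh' : b.height l' = b.height k - b.height i := b.height_sub hlr'
    have h0 := b.height_ne_zero l
    have h0' := b.height_ne_zero l'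
    have hn3 : P.pairingIn ℤ j i = 3 := by
      have hub : P.pairingIn ℤ j i ≤ 3 := by
        simp only [Set.mem_insert_iff, Set.mem_singleton_iff, Prod.mk.injEq] at hset
        omega
      have hlb : 2 < P.pairingIn ℤ j i := by
        rw [RootPairing.Base.isPos_iff] at hpos
        by_contra hlb
        push Not at hlb
        nlinarith [show 0 < b.height l by omega, show 0 < b.height l' by omega]
      omega
    have hkr : P.root k = (3 : ℤ) • P.root i - P.root j := by
      have := root_smul_reflW (1 : P.weylGroup) i j
      rw [hk, root_reflW_self]
      simp only [one_smul] at this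
      rw [this, hn3]
      module
    refine ⟨l, hl, l', hl', ?_, ?_, ?_⟩
    · rw [RootPairing.Base.isPos_iff]; omega
    · rw [RootPairing.Base.isPos_iff]; omega
    · rw [hlr, hlr', hkr]
      module
  obtain ⟨j, hj, k, hk, hjp, hkp, hr⟩ := hdec
  have hh := b.height_add hr
  have hwr : P.root (w⁻¹ • i) = P.root (w⁻¹ • j) + P.root (w⁻¹ • k) := by
    rw [root_smul, root_smul, root_smul, hr, smul_add]
  have hwh := b.height_add hwr
  rw [RootPairing.Base.isPos_iff] at hjp hkp
  have : ¬ b.IsPos (w⁻¹ • j) ∨ ¬ b.IsPos (w⁻¹ • k) := by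
    simp only [RootPairing.Base.isPos_iff] at hw ⊢
    omega
  rcases this with h | h
  · exact ih _ (by omega) hj hjp h rfl
  · exact ih _ (by omega) hk hkp h rfl

end Reflections

/-! ### Bruhat covers for a reflection subsystem, and intervals of length two -/

section Covers

variable {ι R M N : Type*} [Field R] [CharZero R] [AddCommGroup M] [Module R M]
  [AddCommGroup N] [Module R N] {P : RootPairing ι R M N} [P.IsCrystallographic]
  {b : P.Base} {Ψ : Set ι} [Finite ι]

variable (b Ψ) in
/-- The covering relation of the Bruhat order attached to the closed set of roots `Ψ`. -/
def Cover (x y : P.weylGroup) : Prop :=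
  ∃ d ∈ Ψ, b.IsPos d ∧ x = reflW P d * y ∧ invCount b Ψ x = invCount b Ψ y + 1

theorem Cover.invCount_eq {x y : P.weylGroup} (h : Cover b Ψ x y) :
    invCount b Ψ x = invCount b Ψ y + 1 := h.choose_spec.2.2.2

theorem Cover.of_eq (hΨ : IsReflClosed P Ψ) {x y : P.weylGroup} {d : ι} (hd : d ∈ Ψ)
    (h : x = reflW P d * y) (hc : invCount b Ψ x = invCount b Ψ y + 1) : Cover b Ψ x y := by
  by_cases hp : b.IsPos d
  · exact ⟨d, hd, hp, h, hc⟩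
  · exact ⟨reflW P d • d, hΨ _ hd _ hd, by rwa [isPos_neg], by rwa [reflW_neg], hc⟩

theorem isPos_reflW_mul_inv_smul (a : ι) (w : P.weylGroup) :
    b.IsPos ((reflW P a * w)⁻¹ • a) ↔ ¬ b.IsPos (w⁻¹ • a) := by
  rw [reflW_mul_inv_smul, isPos_smul_neg]

theorem reflW_mul_reflW_mul (a d : ι) (w : P.weylGroup) :
    reflW P a * (reflW P d * w) = reflW P (reflW P a • d) * (reflW P a * w) := by
  rw [reflW_conj]
  simp [mul_assoc]

theorem Cover.reflW_self (hΨ : IsReflClosed P Ψ) {a : ι} (ha : IsSimpleIn b Ψ a)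
    {w : P.weylGroup} (hw : b.IsPos (w⁻¹ • a)) : Cover b Ψ (reflW P a * w) w :=
  ⟨a, ha.1, ha.2.1, rfl, invCount_reflW_of_isPos hΨ ha hw⟩

theorem Cover.self_reflW (hΨ : IsReflClosed P Ψ) {a : ι} (ha : IsSimpleIn b Ψ a)
    {w : P.weylGroup} (hw : ¬ b.IsPos (w⁻¹ • a)) : Cover b Ψ w (reflW P a * w) :=
  ⟨a, ha.1, ha.2.1, by rw [reflW_mul_cancel], invCount_reflW_of_not_isPos hΨ ha hw⟩

theorem Cover.reflW_mul (hΨ : IsReflClosed P Ψ) {a : ι} (ha : IsSimpleIn b Ψ a)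
    {w y : P.weylGroup} (h : Cover b Ψ w y)
    (hwy : b.IsPos (w⁻¹ • a) ↔ b.IsPos (y⁻¹ • a)) :
    Cover b Ψ (reflW P a * w) (reflW P a * y) := by
  have hc := h.invCount_eq
  obtain ⟨d, hd, hp, rfl, -⟩ := h
  refine Cover.of_eq hΨ (hΨ _ ha.1 _ hd) (reflW_mul_reflW_mul a d y) ?_
  by_cases hy : b.IsPos (y⁻¹ • a)
  · rw [invCount_reflW_of_isPos hΨ ha hy, invCount_reflW_of_isPos hΨ ha (hwy.mpr hy), hc]
  · have h1 := invCount_reflW_of_not_isPos hΨ ha hy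
    have h2 := invCount_reflW_of_not_isPos hΨ ha (hwy.not.mpr hy)
    omega

/-- The lifting property. -/
theorem Cover.eq_reflW_mul (hΨ : IsReflClosed P Ψ) {a : ι} (ha : IsSimpleIn b Ψ a)
    {w y : P.weylGroup} (h : Cover b Ψ w y) (hw : ¬ b.IsPos (w⁻¹ • a))
    (hy : b.IsPos (y⁻¹ • a)) : w = reflW P a * y := by
  have hc := h.invCount_eq
  obtain ⟨d, hd, hp, rfl, -⟩ := h
  by_contra hne
  have hda : d ≠ a := by rintro rfl; exact hne rfl
  have h1 := invCount_reflW_of_isPos hΨ ha hy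
  have h2 := invCount_reflW_of_not_isPos hΨ ha hw
  -- If `d ≠ a`, the root `s_a d` is still positive and its reflection takes `s_a y` up to `s_a w`.
  -- But `s_a y` has one inversion more than `y`, while `s_a w` has as many as `y`.
  have hpos : b.IsPos (y⁻¹ • d) := (isPos_inv_smul_iff hΨ hd hp).mpr (by omega)
  have h3 := invCount_lt hΨ (hΨ _ ha.1 _ hd) (ha.2.2 d hd hp hda) (w := reflW P a * y)
    (by rwa [reflW_mul_inv_smul, reflW_smul_cancel])
  rw [← reflW_mul_reflW_mul] at h3
  omega

variable (b Ψ) in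
/-- The elements strictly between `x` and `z`, for `x` two steps above `z`. -/
def between (x z : P.weylGroup) : Set P.weylGroup := {n | Cover b Ψ x n ∧ Cover b Ψ n z}

theorem between_invCount {x z n : P.weylGroup} (h : n ∈ between b Ψ x z) :
    invCount b Ψ x = invCount b Ψ z + 2 := by
  have h1 := h.1.invCount_eq
  have h2 := h.2.invCount_eq
  omega

/-- On the way down from `x` to `z` the descent `a` is lost in exactly one of the two steps, and the
lifting property says that this step is multiplication by `s_a`. -/
theorem eq_of_mem_between (hΨ : IsReflClosed P Ψ) {a : ι} (ha : IsSimpleIn b Ψ a)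
    {x z n : P.weylGroup} (hx : ¬ b.IsPos (x⁻¹ • a)) (hz : b.IsPos (z⁻¹ • a))
    (hn : n ∈ between b Ψ x z) : n = reflW P a * x ∨ n = reflW P a * z := by
  by_cases h : b.IsPos (n⁻¹ • a)
  · left
    rw [hn.1.eq_reflW_mul hΨ ha hx h, reflW_mul_cancel]
  · exact Or.inr (hn.2.eq_reflW_mul hΨ ha h hz)

variable [P.IsReduced]

theorem exists_descent (hΨ : IsReflClosed P Ψ) {w : P.weylGroup} (hw : invCount b Ψ w ≠ 0) :
    ∃ a, IsSimpleIn b Ψ a ∧ ¬ b.IsPos (w⁻¹ • a) := by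
  obtain ⟨i, hi, hp, hn⟩ := Set.nonempty_of_ncard_ne_zero hw
  exact exists_isSimpleIn hΨ hi hp hn

/-- Intervals of length two have exactly two inner elements. -/
theorem ncard_between (hΨ : IsReflClosed P Ψ) {x z m : P.weylGroup}
    (hm : m ∈ between b Ψ x z) : (between b Ψ x z).ncard = 2 := by
  induction hk : invCount b Ψ x using Nat.strong_induction_on generalizing x z m with
  | _ k ih =>
  have hxz := between_invCount hm
  obtain ⟨a, ha, hx⟩ := exists_descent hΨ (b := b) (w := x) (by omega)
  have hx' := invCount_reflW_of_not_isPos hΨ ha hx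
  by_cases hz : b.IsPos (z⁻¹ • a)
  · have hz' := invCount_reflW_of_isPos hΨ ha hz
    have hne : reflW P a * x ≠ reflW P a * z := by
      intro h
      have := mul_left_cancel h
      rw [this] at hxz
      omega
    have hset : between b Ψ x z = {reflW P a * x, reflW P a * z} := by
      refine Set.Subset.antisymm (fun n hn => eq_of_mem_between hΨ ha hx hz hn) ?_
      have hxm : Cover b Ψ x (reflW P a * x) := Cover.self_reflW hΨ ha hx
      have hmz : Cover b Ψ (reflW P a * z) z := Cover.reflW_self hΨ ha hz
      -- Left multiplication by `s_a` conjugates the reflection joining `s_a x` to `z` into the one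
      -- joining `x` to `s_a z`, so either candidate is a midpoint as soon as the other is.
      have hboth : Cover b Ψ (reflW P a * x) z ∧ Cover b Ψ x (reflW P a * z) := by
        rcases eq_of_mem_between hΨ ha hx hz hm with h | h
        · rw [h] at hm
          obtain ⟨d, hd, hp, h1, h2⟩ := hm.2
          refine ⟨hm.2, Cover.of_eq hΨ (hΨ _ ha.1 _ hd) ?_ (by omega)⟩
          rw [← reflW_mul_reflW_mul, ← h1, reflW_mul_cancel]
        · rw [h] at hm
          obtain ⟨d, hd, hp, h1, h2⟩ := hm.1
          refine ⟨Cover.of_eq hΨ (hΨ _ ha.1 _ hd) ?_ (by omega), hm.1⟩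
          conv_lhs => rw [h1]
          rw [reflW_mul_reflW_mul, reflW_mul_cancel]
      rintro n (rfl | rfl)
      · exact ⟨hxm, hboth.1⟩
      · exact ⟨hboth.2, hmz⟩
    rw [hset, Set.ncard_pair hne]
  · classical
    have hxa : b.IsPos ((reflW P a * x)⁻¹ • a) := (isPos_reflW_mul_inv_smul a x).mpr hx
    have hza : b.IsPos ((reflW P a * z)⁻¹ • a) := (isPos_reflW_mul_inv_smul a z).mpr hz
    have hxm : Cover b Ψ x (reflW P a * x) := Cover.self_reflW hΨ ha hx
    have hzm : Cover b Ψ z (reflW P a * z) := Cover.self_reflW hΨ ha hz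
    have hdesc : ∀ n ∈ between b Ψ x z, n ≠ reflW P a * x → ¬ b.IsPos (n⁻¹ • a) := by
      intro n hn hne h
      exact hne (by rw [hn.1.eq_reflW_mul hΨ ha hx h, reflW_mul_cancel])
    -- Here `a` is a descent of both ends. Multiplication by `s_a` moves the interval down by one;
    -- only the midpoint `s_a x` would land on the new top `x`-end, and it is sent to `z` instead.
    let σ : P.weylGroup → P.weylGroup := fun n => if n = reflW P a * x then z else reflW P a * n
    have hσ : ∀ n ∈ between b Ψ x z, σ n ∈ between b Ψ (reflW P a * x) (reflW P a * z) := by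
      intro n hn
      by_cases h : n = reflW P a * x
      · simp only [σ, if_pos h]
        exact ⟨h ▸ hn.2, hzm⟩
      · simp only [σ, if_neg h]
        have hna := hdesc n hn h
        exact ⟨hn.1.reflW_mul hΨ ha (by tauto), hn.2.reflW_mul hΨ ha (by tauto)⟩
    have hcard := ih (k - 1) (by omega) (hσ m hm) (by omega)
    rw [← hcard]
    refine Set.ncard_congr (fun n _ => σ n) hσ ?_ ?_
    · have aux : ∀ p ∈ between b Ψ x z, p ≠ reflW P a * x → z ≠ reflW P a * p := by
        intro p hp hpx h
        have := hdesc p hp hpx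
        rw [h, isPos_reflW_mul_inv_smul] at hz
        exact hz this
      intro n p hn hp hnp
      by_cases h : n = reflW P a * x <;> by_cases h' : p = reflW P a * x <;>
        simp only [σ, if_pos, if_neg, h, h', not_false_eq_true] at hnp
      · rw [h, h']
      · exact absurd hnp (aux p hp h')
      · exact absurd hnp.symm (aux n hn h)
      · exact mul_left_cancel hnp
    · intro p hp
      by_cases hpa : b.IsPos (p⁻¹ • a)
      · refine ⟨reflW P a * p, ⟨?_, ?_⟩, ?_⟩
        · have := hp.1.reflW_mul hΨ ha (by tauto)
          rwa [reflW_mul_cancel] at this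
        · have := hp.2.reflW_mul hΨ ha (by tauto)
          rwa [reflW_mul_cancel] at this
        · have : reflW P a * p ≠ reflW P a * x := by
            intro h
            rw [mul_left_cancel h] at hpa
            exact hx hpa
          simp only [σ, if_neg this, reflW_mul_cancel]
      · have hpz : p = z := by rw [hp.2.eq_reflW_mul hΨ ha hpa hza, reflW_mul_cancel]
        refine ⟨reflW P a * x, ⟨hxm, hpz ▸ hp.1⟩, ?_⟩
        simp only [σ, if_true, hpz]

/-! ### Signs on the edges of the Bruhat graph -/

theorem prod_between [Finite P.weylGroup] (hΨ : IsReflClosed P Ψ) {x z : P.weylGroup}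
    (f : P.weylGroup → ℤˣ) {y y' : P.weylGroup} (hy : y ∈ between b Ψ x z)
    (hy' : y' ∈ between b Ψ x z) (hne : y ≠ y') :
    ∏ c ∈ (Set.toFinite (between b Ψ x z)).toFinset, f c = f y * f y' := by
  classical
  have hcard := ncard_between hΨ hy
  have : (Set.toFinite (between b Ψ x z)).toFinset = {y, y'} := by
    symm
    refine Finset.eq_of_subset_of_card_le ?_ ?_
    · intro c hc
      rw [Finset.mem_insert, Finset.mem_singleton] at hc
      rcases hc with rfl | rfl <;> simpa
    · rw [Finset.card_pair hne, ← Set.ncard_eq_toFinset_card, hcard]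
  rw [this, Finset.prod_pair hne]

/-- In an interval of length three, if all squares but one anticommute, then so does the
last one. -/
theorem square_of_squares [Finite P.weylGroup] (hΨ : IsReflClosed P Ψ)
    (E : P.weylGroup → P.weylGroup → ℤˣ) {x t z y y' : P.weylGroup}
    (hzt : Cover b Ψ z t)
    (htop : ∀ u c c', u ≠ z → Cover b Ψ u t → c ∈ between b Ψ x u → c' ∈ between b Ψ x u →
      c ≠ c' → E x c * E c u * (E x c' * E c' u) = -1)
    (hbot : ∀ c u u', Cover b Ψ x c → u ∈ between b Ψ c t → u' ∈ between b Ψ c t →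
      u ≠ u' → E c u * E u t * (E c u' * E u' t) = -1)
    (hy : y ∈ between b Ψ x z) (hy' : y' ∈ between b Ψ x z) (hne : y ≠ y') :
    E x y * E y z * (E x y' * E y' z) = -1 := by
  classical
  have := Fintype.ofFinite P.weylGroup
  let S : P.weylGroup → P.weylGroup → Finset P.weylGroup :=
    fun p q => (Set.toFinite (between b Ψ p q)).toFinset
  have hS : ∀ p q n, n ∈ S p q ↔ Cover b Ψ p n ∧ Cover b Ψ n q := by
    intro p q n; simp [S, between]
  -- `A` consists of the elements just above the bottom `t`, and `C` of those just below the top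
  -- `x`. Each edge at the top or the bottom lies in two squares, so its sign cancels in the product
  -- over all squares; the middle edges occur once on either side, and `A` and `C` have equal size.
  let A : Finset P.weylGroup := Finset.univ.filter fun u => Cover b Ψ u t ∧ (S x u).Nonempty
  let C : Finset P.weylGroup := Finset.univ.filter fun c => Cover b Ψ x c ∧ (S c t).Nonempty
  have hcomm : ∀ u c, u ∈ A ∧ c ∈ S x u ↔ u ∈ S c t ∧ c ∈ C := by
    intro u c
    simp only [A, C, Finset.mem_filter, Finset.mem_univ, true_and, hS]
    constructor
    · rintro ⟨⟨h1, -⟩, h2, h3⟩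
      exact ⟨⟨h3, h1⟩, h2, ⟨u, (hS _ _ _).mpr ⟨h3, h1⟩⟩⟩
    · rintro ⟨⟨h3, h1⟩, h2, -⟩
      exact ⟨⟨h1, ⟨c, (hS _ _ _).mpr ⟨h2, h3⟩⟩⟩, h2, h3⟩
  have hcard : ∀ p q, (S p q).Nonempty → (S p q).card = 2 := by
    rintro p q ⟨n, hn⟩
    rw [← ncard_between hΨ ((hS _ _ _).mp hn), Set.ncard_eq_toFinset_card]
  have hpair : ∀ p q, (S p q).Nonempty → ∃ c c', c ≠ c' ∧ S p q = {c, c'} := fun p q h =>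
    Finset.card_eq_two.mp (hcard p q h)
  have hsq : ∀ g : ℤˣ, g ^ 2 = 1 := Int.units_sq
  have e1 : ∏ u ∈ A, ∏ c ∈ S x u, E x c = 1 := by
    rw [Finset.prod_comm' hcomm]
    refine Finset.prod_eq_one fun c hc => ?_
    rw [Finset.prod_const, hcard c t (Finset.mem_filter.mp hc).2.2, hsq]
  have e2 : ∏ c ∈ C, ∏ u ∈ S c t, E u t = 1 := by
    rw [← Finset.prod_comm' hcomm]
    refine Finset.prod_eq_one fun c hc => ?_
    rw [Finset.prod_const, hcard x c (Finset.mem_filter.mp hc).2.2, hsq]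
  have e3 : ∏ u ∈ A, ∏ c ∈ S x u, E c u = ∏ c ∈ C, ∏ u ∈ S c t, E c u :=
    Finset.prod_comm' hcomm
  have e4 : A.card = C.card := by
    have h1 : ∑ u ∈ A, ∑ c ∈ S x u, 1 = ∑ c ∈ C, ∑ u ∈ S c t, 1 := Finset.sum_comm' hcomm
    have h2 : ∑ u ∈ A, ∑ c ∈ S x u, 1 = A.card * 2 :=
      Finset.sum_const_nat fun u hu => by simp [hcard x u (Finset.mem_filter.mp hu).2.2]
    have h3 : ∑ c ∈ C, ∑ u ∈ S c t, 1 = C.card * 2 :=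
      Finset.sum_const_nat fun c hc => by simp [hcard c t (Finset.mem_filter.mp hc).2.2]
    omega
  have e5 : ∏ u ∈ A, ∏ c ∈ S x u, (E x c * E c u) =
      ∏ c ∈ C, ∏ u ∈ S c t, (E c u * E u t) := by
    simp only [Finset.prod_mul_distrib]
    rw [e1, e2, e3, one_mul, mul_one]
  have e6 : ∏ c ∈ C, ∏ u ∈ S c t, (E c u * E u t) = (-1) ^ C.card := by
    rw [← Finset.prod_const]
    refine Finset.prod_congr rfl fun c hc => ?_
    obtain ⟨hc1, hc2⟩ := (Finset.mem_filter.mp hc).2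
    obtain ⟨u, u', huu, hset⟩ := hpair c t hc2
    have hu : u ∈ between b Ψ c t := (hS _ _ _).mp (by rw [hset]; simp)
    have hu' : u' ∈ between b Ψ c t := (hS _ _ _).mp (by rw [hset]; simp)
    rw [hset, Finset.prod_pair huu, hbot c u u' hc1 hu hu' huu]
  have hzA : z ∈ A := by
    simp only [A, Finset.mem_filter, Finset.mem_univ, true_and]
    exact ⟨hzt, ⟨y, (hS _ _ _).mpr hy⟩⟩
  have e7 : ∏ u ∈ A.erase z, ∏ c ∈ S x u, (E x c * E c u) = (-1) ^ (A.erase z).card := by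
    rw [← Finset.prod_const]
    refine Finset.prod_congr rfl fun u hu => ?_
    obtain ⟨huz, huA⟩ := Finset.mem_erase.mp hu
    obtain ⟨hu1, hu2⟩ := (Finset.mem_filter.mp huA).2
    obtain ⟨c, c', hcc, hset⟩ := hpair x u hu2
    have hc : c ∈ between b Ψ x u := (hS _ _ _).mp (by rw [hset]; simp)
    have hc' : c' ∈ between b Ψ x u := (hS _ _ _).mp (by rw [hset]; simp)
    rw [hset, Finset.prod_pair hcc, htop u c c' huz hu1 hc hc' hcc]
  rw [← Finset.mul_prod_erase A _ hzA, e6, e7,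
    prod_between hΨ (fun c => E x c * E c z) hy hy' hne, ← e4,
    ← Finset.card_erase_add_one hzA, pow_succ'] at e5
  exact mul_right_cancel e5

/-- Induction on the inversion count of the top element `x`, with a descent `a` of `x`. Squares
whose bottom has `a` as an ascent determine the new signs. The remaining squares follow from an
interval of length three. -/
theorem exists_sign_le [Finite P.weylGroup] (hΨ : IsReflClosed P Ψ) (n : ℕ) :
    ∃ E : P.weylGroup → P.weylGroup → ℤˣ, ∀ x y y' z, invCount b Ψ x ≤ n → y ≠ y' →
      y ∈ between b Ψ x z → y' ∈ between b Ψ x z →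
      E x y * E y z * (E x y' * E y' z) = -1 := by
  classical
  induction n with
  | zero =>
    refine ⟨fun _ _ => 1, fun x y y' z hx _ hy _ => ?_⟩
    have := between_invCount hy
    omega
  | succ n ih =>
    obtain ⟨E, hE⟩ := ih
    rcases isEmpty_or_nonempty ι with hι | hι
    · refine ⟨E, fun x y y' z hx => hE x y y' z ?_⟩
      rw [invCount, Set.eq_empty_of_isEmpty (inversions b Ψ x), Set.ncard_empty]
      exact Nat.zero_le n
    have hch : ∀ x, ∃ a, invCount b Ψ x ≠ 0 → IsSimpleIn b Ψ a ∧ ¬ b.IsPos (x⁻¹ • a) := by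
      intro x
      by_cases hx : invCount b Ψ x = 0
      · exact ⟨hι.some, fun h => absurd hx h⟩
      · obtain ⟨a, ha⟩ := exists_descent hΨ hx
        exact ⟨a, fun _ => ha⟩
    choose a ha using hch
    -- The edge from `x` to `s_a x` gets the sign 1; the sign from `x` to any other `y` is then
    -- dictated by the square with corners `x`, `s_a x`, `y`, `s_a y`.
    let E' : P.weylGroup → P.weylGroup → ℤˣ := fun x y =>
      if invCount b Ψ x ≤ n then E x y
      else if y = reflW P (a x) * x then 1
      else -(E (reflW P (a x) * x) (reflW P (a x) * y) * E y (reflW P (a x) * y))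
    have hle : ∀ x y, invCount b Ψ x ≤ n → E' x y = E x y := fun x y h => if_pos h
    have easy : ∀ x y y' z, invCount b Ψ x = n + 1 → y ≠ y' →
        y ∈ between b Ψ x z → y' ∈ between b Ψ x z → b.IsPos (z⁻¹ • a x) →
        E' x y * E' y z * (E' x y' * E' y' z) = -1 := by
      intro x y y' z hx hne hy hy' hz
      obtain ⟨hsimp, hdesc⟩ := ha x (by omega)
      have main : ∀ y y', y ∈ between b Ψ x z → y' ∈ between b Ψ x z → y ≠ y' →
          y = reflW P (a x) * x → y' = reflW P (a x) * z →
          E' x y * E' y z * (E' x y' * E' y' z) = -1 := by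
        intro y y' hy hy' hne h h'
        have c1 := hy.1.invCount_eq
        have c2 := hy'.1.invCount_eq
        rw [hle y z (by omega), hle y' z (by omega)]
        have h1 : E' x y = 1 := by
          simp only [E']
          rw [if_neg (by omega), if_pos h]
        have h2 : E' x y' = -(E y z * E y' z) := by
          simp only [E']
          rw [if_neg (by omega), if_neg (by rw [← h]; exact hne.symm), ← h, h', reflW_mul_cancel]
        rw [h1, h2]
        rcases Int.units_eq_one_or (E y z) with e | e <;>
          rcases Int.units_eq_one_or (E y' z) with e' | e' <;> rw [e, e'] <;> decide
      rcases eq_of_mem_between hΨ hsimp hdesc hz hy with h | h <;>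
        rcases eq_of_mem_between hΨ hsimp hdesc hz hy' with h' | h'
      · exact absurd (h.trans h'.symm) hne
      · exact main y y' hy hy' hne h h'
      · rw [mul_comm]
        exact main y' y hy' hy hne.symm h' h
      · exact absurd (h.trans h'.symm) hne
    refine ⟨E', fun x y y' z hx hne hy hy' => ?_⟩
    have c1 := hy.1.invCount_eq
    have c2 := hy'.1.invCount_eq
    rcases Nat.lt_or_ge n (invCount b Ψ x) with hlt | hge
    · have hxn : invCount b Ψ x = n + 1 := by omega
      by_cases hz : b.IsPos (z⁻¹ • a x)
      · exact easy x y y' z hxn hne hy hy' hz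
      obtain ⟨hsimp, hdesc⟩ := ha x (by omega)
      -- Now `a` is a descent of `z`, and the interval is extended down to `t = s_a z`. By lifting,
      -- `z` is the only element just above `t` with `a` as a descent, so every other square with
      -- top `x` is of the settled kind; the lower squares come from induction.
      refine square_of_squares hΨ E' (t := reflW P (a x) * z) (Cover.self_reflW hΨ hsimp hz)
        ?_ ?_ hy hy' hne
      · intro u c c' hu hut hc hc' hcc
        refine easy x c c' u hxn hcc hc hc' ?_
        by_contra hua
        refine hu ?_
        rw [hut.eq_reflW_mul hΨ hsimp hua ((isPos_reflW_mul_inv_smul _ _).mpr hz),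
          reflW_mul_cancel]
      · intro c u u' hc hu hu' huu
        have d1 := hc.invCount_eq
        have d2 := hu.1.invCount_eq
        have d3 := hu'.1.invCount_eq
        rw [hle c u (by omega), hle c u' (by omega), hle u _ (by omega), hle u' _ (by omega)]
        exact hE c u u' _ (by omega) huu hu hu'
    · rw [hle x y hge, hle x y' hge, hle y z (by omega), hle y' z (by omega)]
      exact hE x y y' z hge hne hy hy'

/-- There are signs on the edges of the Bruhat graph for which all squares anticommute. -/
theorem exists_sign [Finite P.weylGroup] (hΨ : IsReflClosed P Ψ) :
    ∃ E : P.weylGroup → P.weylGroup → ℤˣ, ∀ x y y' z, y ≠ y' →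
      y ∈ between b Ψ x z → y' ∈ between b Ψ x z →
      E x y * E y z * (E x y' * E y' z) = -1 := by
  obtain ⟨E, hE⟩ := exists_sign_le hΨ (b := b) (Nat.card ι)
  exact ⟨E, fun x y y' z => hE x y y' z (Set.ncard_le_card _)⟩

/-! ### The length as a number of inversions -/

theorem isReflClosed_univ : IsReflClosed P Set.univ := fun _ _ _ _ => trivial

theorem isSimpleIn_univ {a : ι} (ha : a ∈ b.support) : IsSimpleIn b Set.univ a :=
  ⟨trivial, RootPairing.Base.isPos_of_mem_support ha,
    fun _ _ hj hja => hj.reflectionPerm ha hja⟩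

theorem inversions_one : inversions b Ψ 1 = ∅ := by
  ext i
  simp only [inversions, inv_one, one_smul, Set.mem_ofPred_eq, Set.mem_empty_iff_false]
  tauto

/-- The exchange property. -/
theorem exists_word_reflW_mul (L : List ι) (hL : ∀ i ∈ L, i ∈ b.support) {β : ι}
    (hβ : b.IsPos β) (hneg : ¬ b.IsPos ((L.map (reflW P)).prod⁻¹ • β)) :
    ∃ L' : List ι, (∀ i ∈ L', i ∈ b.support) ∧ L'.length + 1 = L.length ∧
      (L'.map (reflW P)).prod = reflW P β * (L.map (reflW P)).prod := by
  induction L generalizing β with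
  | nil => simp [hβ] at hneg
  | cons c L ih =>
    rw [List.map_cons, List.prod_cons] at hneg ⊢
    by_cases hc : β = c
    · exact ⟨L, fun i hi => hL i (List.mem_cons_of_mem _ hi), by simp, by simp [hc]⟩
    · obtain ⟨L', h1, h2, h3⟩ := ih (fun i hi => hL i (List.mem_cons_of_mem _ hi))
        ((isSimpleIn_univ (hL c (by simp))).2.2 β trivial hβ hc)
        (by rwa [reflW_mul_inv_smul] at hneg)
      refine ⟨c :: L', ?_, by simp [h2], ?_⟩
      · intro i hi
        rcases List.mem_cons.mp hi with rfl | hi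
        · exact hL _ (by simp)
        · exact h1 i hi
      · rw [List.map_cons, List.prod_cons, h3, reflW_mul_reflW_mul, reflW_smul_cancel]

/-- Prepending a letter to a word of the right length either adds one inversion, or, by exchange,
amounts to deleting a letter. -/
theorem exists_word_length_eq (L : List ι) (hL : ∀ i ∈ L, i ∈ b.support) :
    ∃ L' : List ι, (∀ i ∈ L', i ∈ b.support) ∧
      (L'.map (reflW P)).prod = (L.map (reflW P)).prod ∧
      L'.length = invCount b Set.univ (L.map (reflW P)).prod := by
  induction L with
  | nil => exact ⟨[], by simp, rfl, by simp [invCount, inversions_one]⟩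
  | cons c L ih =>
    obtain ⟨L', h1, h2, h3⟩ := ih fun i hi => hL i (List.mem_cons_of_mem _ hi)
    have hc := hL c (by simp)
    rw [List.map_cons, List.prod_cons]
    by_cases hp : b.IsPos ((L.map (reflW P)).prod⁻¹ • c)
    · refine ⟨c :: L', ?_, by simp [h2], ?_⟩
      · intro i hi
        rcases List.mem_cons.mp hi with rfl | hi
        · exact hc
        · exact h1 i hi
      · rw [invCount_reflW_of_isPos isReflClosed_univ (isSimpleIn_univ hc) hp, ← h3,
          List.length_cons]
    · rw [← h2] at hp
      obtain ⟨L'', k1, k2, k3⟩ := exists_word_reflW_mul L' h1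
        (RootPairing.Base.isPos_of_mem_support hc) hp
      refine ⟨L'', k1, by rw [k3, h2], ?_⟩
      have := invCount_reflW_of_not_isPos isReflClosed_univ (isSimpleIn_univ hc) hp
      rw [h2] at this
      omega

theorem invCount_prod_le (L : List ι) (hL : ∀ i ∈ L, i ∈ b.support) :
    invCount b Set.univ (L.map (reflW P)).prod ≤ L.length := by
  induction L with
  | nil => simp [invCount, inversions_one]
  | cons c L ih =>
    have ih := ih fun i hi => hL i (List.mem_cons_of_mem _ hi)
    have hc := isSimpleIn_univ (hL c (by simp))
    rw [List.map_cons, List.prod_cons, List.length_cons]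
    by_cases hp : b.IsPos ((L.map (reflW P)).prod⁻¹ • c)
    · rw [invCount_reflW_of_isPos isReflClosed_univ hc hp]
      omega
    · have := invCount_reflW_of_not_isPos isReflClosed_univ hc hp
      omega

variable (b) in
/-- The Weyl group is generated by the simple reflections. -/
theorem exists_word (w : P.weylGroup) :
    ∃ L : List ι, (∀ i ∈ L, i ∈ b.support) ∧ (L.map (reflW P)).prod = w := by
  have hinv : ∀ L : List ι, (L.map (reflW P)).prod⁻¹ = (L.reverse.map (reflW P)).prod := by
    intro L
    induction L with
    | nil => simp
    | cons c L ih => simp only [List.map_cons, List.prod_cons, mul_inv_rev, ih, reflW_inv,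
        List.reverse_cons, List.map_append, List.prod_append, List.map_nil, List.prod_nil, mul_one]
  have hrefl : ∀ i, ∃ L : List ι, (∀ i ∈ L, i ∈ b.support) ∧
      (L.map (reflW P)).prod = reflW P i := by
    intro i
    induction i using b.induction_reflect with
    | h₀ i ih => rw [← reflW_smul, reflW_neg]; exact ih
    | h₁ i hi => exact ⟨[i], by simpa, by simp⟩
    | h₂ i j ih hj =>
      obtain ⟨L, h1, h2⟩ := ih
      refine ⟨j :: (L ++ [j]), ?_, ?_⟩
      · intro k hk
        simp only [List.mem_cons, List.mem_append, List.not_mem_nil, or_false] at hk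
        rcases hk with rfl | hk | rfl
        · exact hj
        · exact h1 k hk
        · exact hj
      · rw [← reflW_smul, reflW_conj, reflW_inv, List.map_cons, List.prod_cons, List.map_append,
          List.prod_append, h2]
        simp [mul_assoc]
  obtain ⟨w, hw⟩ := w
  induction hw using RootPairing.weylGroup.induction with
  | mem i => exact hrefl i
  | one => exact ⟨[], by simp, rfl⟩
  | mul x y hx hy ihx ihy =>
    obtain ⟨L, h1, h2⟩ := ihx
    obtain ⟨L', h1', h2'⟩ := ihy
    refine ⟨L ++ L', ?_, ?_⟩
    · intro i hi
      rcases List.mem_append.mp hi with h | h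
      · exact h1 i h
      · exact h1' i h
    · rw [List.map_append, List.prod_append, h2, h2']
      rfl

/-- The least length of a word for `w` in the simple reflections is the number of inversions. -/
theorem sInf_word_length (w : P.weylGroup) :
    sInf {n | ∃ L : List ι, (∀ i ∈ L, i ∈ b.support) ∧ (L.map (reflW P)).prod = w ∧
      L.length = n} = invCount b Set.univ w := by
  obtain ⟨L, h1, h2⟩ := exists_word b w
  obtain ⟨L', k1, k2, k3⟩ := exists_word_length_eq L h1
  rw [h2] at k2 k3
  refine le_antisymm (Nat.sInf_le ⟨L', k1, k2, k3⟩) ?_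
  refine le_csInf ⟨_, L', k1, k2, k3⟩ ?_
  rintro n ⟨L₁, m1, rfl, rfl⟩
  exact invCount_prod_le L₁ m1

/-- Every root is conjugate to a simple root. -/
theorem exists_smul_mem_support (b : P.Base) (i : ι) :
    ∃ (w : P.weylGroup) (a : ι), a ∈ b.support ∧ i = w • a := by
  induction i using b.induction_reflect with
  | h₀ i ih =>
    obtain ⟨w, a, ha, rfl⟩ := ih
    exact ⟨reflW P (w • a) * w, a, ha, by rw [mul_smul]; rfl⟩
  | h₁ i hi => exact ⟨1, i, hi, (one_smul _ _).symm⟩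
  | h₂ i j ih hj =>
    obtain ⟨w, a, ha, rfl⟩ := ih
    exact ⟨reflW P j * w, a, ha, by rw [mul_smul]; rfl⟩

end Covers

/-! ### Exponentials of endomorphisms of a finite-dimensional complex vector space -/

section Exponential

/-- `T = exp A`, tested against all linear functionals. -/
def IsExp {E : Type*} [AddCommGroup E] [Module ℂ E] (A T : E →ₗ[ℂ] E) : Prop :=
  ∀ (y : E) (f : Dual ℂ E), HasSum (fun n : ℕ => (n.factorial : ℂ)⁻¹ * f ((A ^ n) y)) (f (T y))

theorem IsExp.unique {E : Type*} [AddCommGroup E] [Module ℂ E] {A T T' : E →ₗ[ℂ] E}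
    (h : IsExp A T) (h' : IsExp A T') : T = T' := by
  ext y
  refine sub_eq_zero.mp ((Module.forall_dual_apply_eq_zero_iff ℂ _).mp fun f => ?_)
  rw [map_sub, (h y f).unique (h' y f), sub_self]

/-- The exponential of `A` preserves every subspace that is stable under `A`. -/
theorem IsExp.apply_mem {E : Type*} [AddCommGroup E] [Module ℂ E] {A T : E →ₗ[ℂ] E}
    (h : IsExp A T) {U : Submodule ℂ E} (hU : ∀ x ∈ U, A x ∈ U) {y : E} (hy : y ∈ U) :
    T y ∈ U := by
  by_contra hT
  obtain ⟨f, hf, hfU⟩ := Submodule.exists_le_ker_of_notMem hT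
  have hpow : ∀ n : ℕ, (A ^ n) y ∈ U := by
    intro n
    induction n with
    | zero => simpa
    | succ n ih => rw [pow_succ', Module.End.mul_apply]; exact hU _ ih
  have h0 := h y f
  have : (fun n : ℕ => (n.factorial : ℂ)⁻¹ * f ((A ^ n) y)) = fun _ => 0 := by
    ext n
    rw [LinearMap.mem_ker.mp (hfU (hpow n)), mul_zero]
  rw [this] at h0
  exact hf (h0.unique hasSum_zero)

/-- The exponential is a finite sum on vectors killed by the cube of `A`. -/
theorem IsExp.apply_eq {E : Type*} [AddCommGroup E] [Module ℂ E] {A T : E →ₗ[ℂ] E}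
    (h : IsExp A T) {y : E} (hy : A (A (A y)) = 0) :
    T y = y + A y + (2⁻¹ : ℂ) • A (A y) := by
  refine (Module.forall_dual_apply_eq_zero_iff ℂ _).mp ?_ |> sub_eq_zero.mp
  intro f
  have h1 : HasSum (fun n : ℕ => (n.factorial : ℂ)⁻¹ * f ((A ^ n) y))
      (∑ n ∈ Finset.range 3, (n.factorial : ℂ)⁻¹ * f ((A ^ n) y)) := by
    refine hasSum_sum_of_ne_finset_zero fun n hn => ?_
    rw [Finset.mem_range, not_lt] at hn
    obtain ⟨k, rfl⟩ := Nat.exists_eq_add_of_le' hn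
    rw [pow_add, Module.End.mul_apply, pow_succ, pow_two]
    simp [hy]
  have h2 := (h y f).unique h1
  rw [map_sub, h2]
  simp [Finset.sum_range_succ, pow_two]

section Normed

variable {E E' : Type*} [NormedAddCommGroup E] [NormedSpace ℂ E] [FiniteDimensional ℂ E]
  [NormedAddCommGroup E'] [NormedSpace ℂ E'] [FiniteDimensional ℂ E']

theorem isExp_exp (A : E →L[ℂ] E) :
    IsExp (A : E →ₗ[ℂ] E) (NormedSpace.exp A : E →L[ℂ] E) := by
  have := FiniteDimensional.complete ℂ E
  intro y f
  have h := NormedSpace.exp_series_hasSum_exp' (𝕂 := ℂ) A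
  let φ : (E →L[ℂ] E) →L[ℂ] ℂ :=
    (LinearMap.toContinuousLinearMap f) ∘L (ContinuousLinearMap.apply ℂ E y)
  have h2 := h.mapL φ
  have e : ∀ n : ℕ, (A : E →ₗ[ℂ] E) ^ n = ((A ^ n : E →L[ℂ] E) : E →ₗ[ℂ] E) := by
    intro n
    ext x
    simp
  have e2 : (fun n : ℕ => (n.factorial : ℂ)⁻¹ * f (((A : E →ₗ[ℂ] E) ^ n) y)) =
      fun n : ℕ => φ ((n.factorial : ℂ)⁻¹ • A ^ n) := by
    ext n
    rw [map_smul, smul_eq_mul, e]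
    rfl
  rw [e2]
  exact h2

theorem continuous_multilinear {r : ℕ} (F : MultilinearMap ℂ (fun _ : Fin r => E) E') :
    Continuous F := by
  classical
  let e := Module.finBasis ℂ E
  have h : ∀ v, F v = ∑ k : Fin r → Fin (finrank ℂ E),
      (∏ i, e.repr (v i) (k i)) • F fun i => e (k i) := by
    intro v
    conv_lhs => rw [show v = fun i => ∑ j, e.repr (v i) j • e j from
      funext fun i => (e.sum_repr (v i)).symm]
    rw [MultilinearMap.map_sum]
    refine Finset.sum_congr rfl fun k _ => ?_
    rw [MultilinearMap.map_smul_univ]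
  have h' : (F : (Fin r → E) → E') = fun v => ∑ k : Fin r → Fin (finrank ℂ E),
      (∏ i, e.repr (v i) (k i)) • F fun i => e (k i) := funext h
  rw [h']
  refine continuous_finsetSum _ fun k _ => Continuous.smul ?_ continuous_const
  refine continuous_finsetProd _ fun i _ => ?_
  exact (LinearMap.continuous_of_finiteDimensional (e.coord (k i))).comp (continuous_apply i)

/-- The hypothesis says that `exp(-tA') F(exp(tA) v)` has derivative zero in `t`; compare `t = 0`
and `t = 1`. -/
theorem exp_apply_multilinear {r : ℕ} (F : MultilinearMap ℂ (fun _ : Fin r => E) E')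
    (A : E →L[ℂ] E) (A' : E' →L[ℂ] E')
    (hF : ∀ v, A' (F v) = ∑ i, F (Function.update v i (A (v i)))) (v : Fin r → E) :
    (NormedSpace.exp A' : E' →L[ℂ] E') (F v) =
      F fun i => (NormedSpace.exp A : E →L[ℂ] E) (v i) := by
  have := FiniteDimensional.complete ℂ E
  have := FiniteDimensional.complete ℂ E'
  let G : ContinuousMultilinearMap ℂ (fun _ : Fin r => E) E' := ⟨F, continuous_multilinear F⟩
  let := NormedAlgebra.restrictScalars ℚ ℂ (E' →L[ℂ] E')
  have hT : ∀ t : ℂ, HasDerivAt (fun u : ℂ => fun i => (NormedSpace.exp (u • A) : E →L[ℂ] E) (v i))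
      (fun i => A ((NormedSpace.exp (t • A) : E →L[ℂ] E) (v i))) t := by
    intro t
    rw [hasDerivAt_pi]
    intro i
    have h := hasDerivAt_exp_smul_const' (𝕂 := ℂ) A t
    exact (ContinuousLinearMap.apply ℂ E (v i)).hasFDerivAt.comp_hasDerivAt t h
  have hX : ∀ t : ℂ, HasDerivAt
      (fun u : ℂ => F fun i => (NormedSpace.exp (u • A) : E →L[ℂ] E) (v i))
      (A' (F fun i => (NormedSpace.exp (t • A) : E →L[ℂ] E) (v i))) t := by
    intro t
    have h := (G.hasFDerivAt (x := fun i => (NormedSpace.exp (t • A) : E →L[ℂ] E) (v i))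
      ).comp_hasDerivAt t (hT t)
    rw [ContinuousMultilinearMap.linearDeriv_apply] at h
    rw [hF]
    exact h
  have hY : ∀ t : ℂ, HasDerivAt
      (fun u : ℂ => (NormedSpace.exp (u • -A') : E' →L[ℂ] E')
        (F fun i => (NormedSpace.exp (u • A) : E →L[ℂ] E) (v i))) 0 t := by
    intro t
    have h := (hasDerivAt_exp_smul_const (𝕂 := ℂ) (-A') t).clm_apply (hX t)
    convert! h using 1
    simp
  have hconst := is_const_of_deriv_eq_zero (fun t => (hY t).differentiableAt)
    (fun t => (hY t).deriv) 1 0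
  simp only [one_smul, zero_smul, NormedSpace.exp_zero, one_apply_eq_self] at hconst
  rw [← hconst, ← mul_apply_eq_comp, ← NormedSpace.exp_add_of_commute
    ((Commute.refl A').neg_right), add_neg_cancel, NormedSpace.exp_zero,
    one_apply_eq_self]

end Normed

variable {E E' : Type*} [AddCommGroup E] [Module ℂ E] [FiniteDimensional ℂ E]
  [AddCommGroup E'] [Module ℂ E'] [FiniteDimensional ℂ E']

variable (E) in
/-- An auxiliary norm on a finite-dimensional complex vector space. -/
noncomputable abbrev auxNorm : NormedAddCommGroup E :=
  NormedAddCommGroup.induced E (Fin (finrank ℂ E) → ℂ) (Module.finBasis ℂ E).equivFun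
    (Module.finBasis ℂ E).equivFun.injective

variable (E) in
/-- The scalar multiplication is compatible with the auxiliary norm. -/
noncomputable abbrev auxNormedSpace : @NormedSpace ℂ E _ (auxNorm E).toSeminormedAddCommGroup :=
  NormedSpace.induced ℂ E (Fin (finrank ℂ E) → ℂ) (Module.finBasis ℂ E).equivFun

theorem exists_isExp (A : E →ₗ[ℂ] E) : ∃ T : E ≃ₗ[ℂ] E, IsExp A T := by
  let := auxNorm E
  let := auxNormedSpace E
  have := FiniteDimensional.complete ℂ E
  let := NormedAlgebra.restrictScalars ℚ ℂ (E →L[ℂ] E)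
  let B : E →L[ℂ] E := LinearMap.toContinuousLinearMap A
  have h1 : (NormedSpace.exp B : E →L[ℂ] E) * NormedSpace.exp (-B) = 1 := by
    rw [← NormedSpace.exp_add_of_commute ((Commute.refl B).neg_right), add_neg_cancel,
      NormedSpace.exp_zero]
  have h2 : (NormedSpace.exp (-B) : E →L[ℂ] E) * NormedSpace.exp B = 1 := by
    rw [← NormedSpace.exp_add_of_commute ((Commute.refl B).neg_left), neg_add_cancel,
      NormedSpace.exp_zero]
  let T : E ≃ₗ[ℂ] E := LinearEquiv.ofLinearMap
    ((NormedSpace.exp B : E →L[ℂ] E) : E →ₗ[ℂ] E) ((NormedSpace.exp (-B) : E →L[ℂ] E) : E →ₗ[ℂ] E)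
    (by ext x; exact congrArg (fun f : E →L[ℂ] E => f x) h1)
    (by ext x; exact congrArg (fun f : E →L[ℂ] E => f x) h2)
  exact ⟨T, isExp_exp B⟩

/-- A multilinear map which intertwines derivations intertwines their exponentials. -/
theorem IsExp.apply_multilinear {r : ℕ} (F : MultilinearMap ℂ (fun _ : Fin r => E) E')
    {A T : E →ₗ[ℂ] E} {A' T' : E' →ₗ[ℂ] E'} (hT : IsExp A T) (hT' : IsExp A' T')
    (hF : ∀ v, A' (F v) = ∑ i, F (Function.update v i (A (v i)))) (v : Fin r → E) :
    T' (F v) = F fun i => T (v i) := by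
  let := auxNorm E
  let := auxNormedSpace E
  let := auxNorm E'
  let := auxNormedSpace E'
  have h1 := hT.unique (isExp_exp (LinearMap.toContinuousLinearMap A))
  have h2 := hT'.unique (isExp_exp (LinearMap.toContinuousLinearMap A'))
  rw [h1, h2]
  exact exp_apply_multilinear F (LinearMap.toContinuousLinearMap A)
    (LinearMap.toContinuousLinearMap A') hF v

end Exponential

/-! ### Multilinear forms and derivations -/

section Forms

variable {E : Type*} [AddCommGroup E] [Module ℂ E] {r : ℕ}

/-- The multilinear forms in `r` variables. -/
abbrev MForm (E : Type*) [AddCommGroup E] [Module ℂ E] (r : ℕ) : Type _ :=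
  MultilinearMap ℂ (fun _ : Fin r => E) ℂ

/-- The derivation of the space of multilinear forms induced by an endomorphism. -/
def der (A : E →ₗ[ℂ] E) : MForm E r →ₗ[ℂ] MForm E r where
  toFun F := ∑ i, F.compLinearMap (Function.update (fun _ => LinearMap.id) i A)
  map_add' F G := by
    ext v
    simp [Finset.sum_add_distrib]
  map_smul' c F := by
    ext v
    simp [Finset.mul_sum]

theorem der_apply (A : E →ₗ[ℂ] E) (F : MForm E r) (v : Fin r → E) :
    der A F v = ∑ i, F (Function.update v i (A (v i))) := by
  simp only [der, LinearMap.coe_mk, AddHom.coe_mk, sum_apply,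
    MultilinearMap.compLinearMap_apply]
  refine Finset.sum_congr rfl fun i _ => congrArg F (funext fun j => ?_)
  by_cases h : j = i
  · subst h; simp
  · simp [h]

theorem der_add (A A' : E →ₗ[ℂ] E) (F : MForm E r) :
    der (A + A') F = der A F + der A' F := by
  ext v
  simp [der_apply, Finset.sum_add_distrib]

theorem der_smul (c : ℂ) (A : E →ₗ[ℂ] E) (F : MForm E r) :
    der (c • A) F = c • der A F := by
  ext v
  simp [der_apply, Finset.mul_sum]

/-- Terms that modify two different slots are symmetric in `A` and `A'` and cancel. In a single slot
the order of composition is reversed, since forms are contravariant. -/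
theorem der_der_sub (A A' : E →ₗ[ℂ] E) (F : MForm E r) :
    der A (der A' F) - der A' (der A F) = der (A' * A - A * A') F := by
  have key : ∀ (A A' : E →ₗ[ℂ] E) (v : Fin r → E), der A (der A' F) v =
      ∑ i, F (Function.update v i (A' (A (v i)))) + ∑ i, ∑ j ∈ Finset.univ.erase i,
        F (Function.update (Function.update v i (A (v i))) j (A' (v j))) := by
    intro A A' v
    rw [der_apply, ← Finset.sum_add_distrib]
    refine Finset.sum_congr rfl fun i _ => ?_
    rw [der_apply, ← Finset.add_sum_erase _ _ (Finset.mem_univ i)]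
    congr 1
    · simp
    · refine Finset.sum_congr rfl fun j hj => ?_
      rw [Function.update_of_ne (Finset.ne_of_mem_erase hj)]
  ext v
  rw [sub_apply, key, key, der_apply]
  have hcomm : ∑ i, ∑ j ∈ Finset.univ.erase i,
        F (Function.update (Function.update v i (A (v i))) j (A' (v j))) =
      ∑ i, ∑ j ∈ Finset.univ.erase i,
        F (Function.update (Function.update v i (A' (v i))) j (A (v j))) := by
    rw [Finset.sum_comm' (t' := Finset.univ) (s' := fun j => Finset.univ.erase j)
      (by intro i j; simp [eq_comm])]
    refine Finset.sum_congr rfl fun j _ => Finset.sum_congr rfl fun i hi => ?_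
    rw [Function.update_comm (Finset.ne_of_mem_erase hi)]
  rw [hcomm, add_sub_add_right_eq_sub, ← Finset.sum_sub_distrib]
  refine Finset.sum_congr rfl fun i _ => ?_
  rw [LinearMap.sub_apply, MultilinearMap.map_update_sub]
  rfl

/-- The composition of a multilinear form with a linear map. -/
abbrev MForm.comp {E' : Type*} [AddCommGroup E'] [Module ℂ E'] (u : E →ₗ[ℂ] E')
    (F : MForm E' r) : MForm E r := F.compLinearMap fun _ => u

theorem der_comp {E' : Type*} [AddCommGroup E'] [Module ℂ E'] {u : E →ₗ[ℂ] E'}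
    {A : E →ₗ[ℂ] E} {A' : E' →ₗ[ℂ] E'} (h : A' ∘ₗ u = u ∘ₗ A) (F : MForm E' r) :
    der A (MForm.comp u F) = MForm.comp u (der A' F) := by
  ext v
  rw [der_apply, MultilinearMap.compLinearMap_apply, der_apply]
  refine Finset.sum_congr rfl fun i _ => ?_
  rw [MultilinearMap.compLinearMap_apply]
  congr 1
  ext j
  by_cases hj : j = i
  · subst hj
    simpa using (LinearMap.congr_fun h (v j)).symm
  · simp [hj]

/-- The exponential of `A` acts on forms through the exponential of the derivation. -/
theorem IsExp.comp_mem [FiniteDimensional ℂ E] {A T : E →ₗ[ℂ] E} (hT : IsExp A T)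
    {U : Submodule ℂ (MForm E r)} (hU : ∀ F ∈ U, der A F ∈ U) {F : MForm E r} (hF : F ∈ U) :
    MForm.comp T F ∈ U := by
  -- Evaluation of the forms in `U` at a tuple intertwines `A` with the transpose of `der A` on the
  -- dual of `U`, hence also their exponentials. Reflexivity of `U` turns the result into a member
  -- of `U`.
  let ev : MultilinearMap ℂ (fun _ : Fin r => E) (Dual ℂ U) :=
    { toFun := fun v =>
        { toFun := fun G => G.1 v
          map_add' := fun _ _ => rfl
          map_smul' := fun _ _ => rfl }
      map_update_add' := fun v i x y => by ext G; exact G.1.map_update_add v i x y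
      map_update_smul' := fun v i c x => by ext G; exact G.1.map_update_smul v i c x }
  let D : U →ₗ[ℂ] U := (der A).restrict hU
  obtain ⟨T', hT'⟩ := exists_isExp D.dualMap
  have h := hT.apply_multilinear ev hT' (fun v => by
    ext G
    rw [LinearMap.sum_apply]
    exact der_apply A G.1 v)
  let G : U := (Module.evalEquiv ℂ U).symm
    ((T' : Dual ℂ U →ₗ[ℂ] Dual ℂ U).dualMap (Module.evalEquiv ℂ U ⟨F, hF⟩))
  have hG : ∀ φ : Dual ℂ U, φ G = T' φ ⟨F, hF⟩ := by
    intro φ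
    have := LinearMap.congr_fun ((Module.evalEquiv ℂ U).apply_symm_apply
      ((T' : Dual ℂ U →ₗ[ℂ] Dual ℂ U).dualMap (Module.evalEquiv ℂ U ⟨F, hF⟩))) φ
    exact this
  have hGF : G.1 = MForm.comp T F := by
    ext v
    have h1 := hG (ev v)
    have h2 := LinearMap.congr_fun (h v) ⟨F, hF⟩
    exact h1.trans h2
  rw [← hGF]
  exact G.2

variable [FiniteDimensional ℂ E]

/-- A nonzero form whose kernel is the subspace `B`: the determinant on the quotient by `B`. -/
noncomputable def detForm (B : Submodule ℂ E) : MForm E (finrank ℂ (E ⧸ B)) :=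
  MForm.comp B.mkQ ((Module.finBasis ℂ (E ⧸ B)).det.toMultilinearMap)

theorem detForm_apply (B : Submodule ℂ E) (v : Fin (finrank ℂ (E ⧸ B)) → E) :
    detForm B v = (Module.finBasis ℂ (E ⧸ B)).det fun i => B.mkQ (v i) := rfl

theorem detForm_ne_zero (B : Submodule ℂ E) : detForm B ≠ 0 := by
  intro h
  let e := Module.finBasis ℂ (E ⧸ B)
  choose v hv using fun i => B.mkQ_surjective (e i)
  have h1 : detForm B v = 0 := by rw [h]; rfl
  rw [detForm_apply] at h1
  simp only [hv] at h1
  exact one_ne_zero (e.det_self.symm.trans h1)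

theorem detForm_update_of_mem {B : Submodule ℂ E} {w : E} (hw : w ∈ B)
    (v : Fin (finrank ℂ (E ⧸ B)) → E) (i) : detForm B (Function.update v i w) = 0 := by
  rw [detForm_apply]
  refine AlternatingMap.map_coord_zero _ i ?_
  simpa using hw

/-- Replacing one vector of a lifted basis of the quotient by `w` reads off a coordinate of `w`
modulo `B`. -/
theorem mem_of_detForm_update {B : Submodule ℂ E} {w : E}
    (hw : ∀ v i, detForm B (Function.update v i w) = 0) : w ∈ B := by
  let e := Module.finBasis ℂ (E ⧸ B)
  choose v hv using fun i => B.mkQ_surjective (e i)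
  rw [← Submodule.Quotient.mk_eq_zero, ← e.repr.map_eq_zero_iff]
  ext i
  have h1 := hw v i
  rw [detForm_apply] at h1
  have h2 : (fun j => B.mkQ (Function.update v i w j)) = Function.update e i (B.mkQ w) := by
    ext j
    by_cases h : j = i
    · subst h; simp
    · simp [h, ← hv]
  rw [h2] at h1
  have h3 : B.mkQ w = ∑ j, e.repr (B.mkQ w) j • e j := (e.sum_repr _).symm
  rw [h3] at h1
  have h4 : e.det (Function.update e i (∑ j, e.repr (B.mkQ w) j • e j)) =
      e.repr (B.mkQ w) i := by
    rw [AlternatingMap.map_update_sum, Finset.sum_eq_single i]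
    · rw [AlternatingMap.map_update_smul, Function.update_eq_self, e.det_self, smul_eq_mul,
        mul_one]
    · intro j _ hj
      rw [AlternatingMap.map_update_smul, AlternatingMap.map_update_self _ _ hj.symm, smul_zero]
    · simp
  exact h4.symm.trans h1

/-- With equal arguments in slots `i` and `j`, the terms modified in these slots differ by a
transposition and cancel; every other term still has two equal arguments. -/
theorem der_alternating {Q : Type*} [AddCommGroup Q] [Module ℂ Q] (A : Q →ₗ[ℂ] Q)
    (f : Q [⋀^Fin r]→ₗ[ℂ] ℂ) :
    ∃ g : Q [⋀^Fin r]→ₗ[ℂ] ℂ, der A f.toMultilinearMap = g.toMultilinearMap := by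
  refine ⟨{ der A f.toMultilinearMap with map_eq_zero_of_eq' := ?_ }, rfl⟩
  intro v i j hij hne
  change der A f.toMultilinearMap v = 0
  rw [der_apply, ← Finset.add_sum_erase _ _ (Finset.mem_univ i),
    ← Finset.add_sum_erase _ _ (Finset.mem_erase.mpr ⟨hne.symm, Finset.mem_univ j⟩), ← add_assoc]
  have h1 : Function.update v j (A (v j)) = Function.update v i (A (v i)) ∘ Equiv.swap i j := by
    ext k
    by_cases hk : k = i
    · subst hk
      simp [hne, hne.symm, hij]
    · by_cases hk' : k = j
      · subst hk'
        simp [hij]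
      · simp [Equiv.swap_apply_of_ne_of_ne hk hk', hk, hk']
  rw [h1, Finset.sum_eq_zero, add_zero]
  · exact f.map_add_swap _ hne
  · intro k hk
    simp only [Finset.mem_erase, Finset.mem_univ, and_true] at hk
    refine f.map_eq_zero_of_eq _ ?_ hne
    rw [Function.update_of_ne hk.2.symm, Function.update_of_ne hk.1.symm, hij]

/-- The derivative is pulled back from an alternating form of top degree on `E ⧸ B`, and such forms
make up a line. -/
theorem der_detForm {B : Submodule ℂ E} {A : E →ₗ[ℂ] E} (hA : ∀ x ∈ B, A x ∈ B) :
    ∃ χ : ℂ, der A (detForm B) = χ • detForm B := by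
  let e := Module.finBasis ℂ (E ⧸ B)
  let A' : (E ⧸ B) →ₗ[ℂ] (E ⧸ B) := B.mapQ B A hA
  obtain ⟨g, hg⟩ := der_alternating A' e.det
  refine ⟨g e, ?_⟩
  rw [detForm, der_comp (A' := A') (by ext; rfl), hg]
  ext v
  exact congrArg (fun f : (E ⧸ B) [⋀^Fin (finrank ℂ (E ⧸ B))]→ₗ[ℂ] ℂ => f fun i => B.mkQ (v i))
    (g.eq_smul_basis_det e)

end Forms

/-! ### A uniqueness property of extremal vectors -/

section Extremal

variable {M : Type*} [AddCommGroup M] [Module ℂ M]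

theorem eq_zero_of_mem_eigenspace {D : End ℂ M} {ι : Sort*} {μ : ℂ} {f : ι → ℂ}
    (hf : ∀ i, f i ≠ μ) {x : M} (hx : x ∈ D.eigenspace μ) (hx' : x ∈ ⨆ i, D.eigenspace (f i)) :
    x = 0 := by
  have h := (Module.End.eigenspaces_iSupIndep D) μ
  refine Submodule.disjoint_def.mp h x hx ?_
  exact iSup_le (a := ⨆ j, ⨆ _ : j ≠ μ, D.eigenspace j)
    (fun i => le_iSup₂_of_le (f i) (hf i) le_rfl) hx'

/-- For nonzero `G`, the two memberships place `χ'` in `χ + ℕ` and `χ` in `χ' + ℕ`, so `χ = χ'`. The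
part of `G` in the strictly higher eigenspaces then vanishes by independence of eigenspaces. -/
theorem mem_span_of_extremal {D : End ℂ M} {χ χ' : ℂ} {F G : M} (hF : D F = χ • F)
    (hG : D G = χ' • G) (hF0 : F ≠ 0)
    (h : G ∈ Submodule.span ℂ {F} ⊔ ⨆ n : ℕ, D.eigenspace (χ + (n + 1)))
    (h' : F ∈ Submodule.span ℂ {G} ⊔ ⨆ n : ℕ, D.eigenspace (χ' + (n + 1))) :
    G ∈ Submodule.span ℂ {F} := by
  have hFe : F ∈ D.eigenspace χ := Module.End.mem_eigenspace_iff.mpr hF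
  have hGe : G ∈ D.eigenspace χ' := Module.End.mem_eigenspace_iff.mpr hG
  have hle : ∀ (F : M) (χ : ℂ), F ∈ D.eigenspace χ →
      Submodule.span ℂ {F} ⊔ ⨆ n : ℕ, D.eigenspace (χ + (n + 1)) ≤
        ⨆ n : ℕ, D.eigenspace (χ + n) := by
    intro F χ hF
    refine sup_le ?_ (iSup_le fun n => ?_)
    · rw [Submodule.span_singleton_le_iff_mem]
      exact Submodule.mem_iSup_of_mem 0 (by simpa using hF)
    · refine le_iSup_of_le (n + 1) ?_
      push_cast
      exact le_rfl
  by_cases hn : ∃ n : ℕ, χ' = χ + (n + 1)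
  · exfalso
    obtain ⟨n, hn⟩ := hn
    refine hF0 (eq_zero_of_mem_eigenspace (f := fun m : ℕ => χ' + m) ?_ hFe (hle G χ' hGe h'))
    intro m hm
    rw [hn] at hm
    have h1 : (n : ℂ) + 1 + m = 0 := by linear_combination hm
    norm_cast at h1
    omega
  · push Not at hn
    by_cases heq : χ' = χ
    · obtain ⟨x, hx, y, hy, hxy⟩ := Submodule.mem_sup.mp h
      obtain ⟨a, rfl⟩ := Submodule.mem_span_singleton.mp hx
      have hy0 : y = 0 := by
        refine eq_zero_of_mem_eigenspace (f := fun n : ℕ => χ + (n + 1)) (μ := χ) ?_ ?_ hy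
        · intro n hn'
          exact hn n (by rw [heq, hn'])
        · have : y = G - a • F := by rw [← hxy]; abel
          rw [this]
          exact Submodule.sub_mem _ (heq ▸ hGe) (Submodule.smul_mem _ _ hFe)
      rw [← hxy, hy0, add_zero]
      exact hx
    · have : G = 0 := by
        refine eq_zero_of_mem_eigenspace (f := fun n : ℕ => χ + n) ?_ hGe (hle F χ hFe h)
        intro n hn'
        rcases n with _ | n
        · exact heq (by simpa using hn'.symm)
        · exact hn n (by rw [← hn']; push_cast; ring)
      rw [this]
      exact Submodule.zero_mem _

variable {L : Type*} [LieRing L] [LieAlgebra ℂ L]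

/-- The elements of `k` which are lowered by `h`. -/
def lowering (k : LieSubalgebra ℂ L) (h : L) : Set L :=
  {y | y ∈ k ∧ ∃ n : ℕ, ⁅h, y⁆ = (-(n + 1) : ℂ) • y}

/-- The subspace generated from `F` by the elements lowered by `h`. -/
def generated (ρ : L →ₗ[ℂ] End ℂ M) (k : LieSubalgebra ℂ L) (h : L) (F : M) : Submodule ℂ M :=
  sInf {U | F ∈ U ∧ ∀ y ∈ lowering k h, ∀ w ∈ U, ρ y w ∈ U}

variable {ρ : L →ₗ[ℂ] End ℂ M} {k : LieSubalgebra ℂ L} {h : L} {F : M}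

theorem mem_generated : F ∈ generated ρ k h F :=
  Submodule.mem_sInf.mpr fun _ hU => hU.1

theorem lowering_generated {y : L} (hy : y ∈ lowering k h) {w : M}
    (hw : w ∈ generated ρ k h F) : ρ y w ∈ generated ρ k h F :=
  Submodule.mem_sInf.mpr fun U hU => hU.2 y hy w (Submodule.mem_sInf.mp hw U hU)

theorem generated_le {U : Submodule ℂ M} (hF : F ∈ U)
    (hU : ∀ y ∈ lowering k h, ∀ w ∈ U, ρ y w ∈ U) : generated ρ k h F ≤ U :=
  sInf_le ⟨hF, hU⟩

variable (hρ : ∀ x y m, ρ x (ρ y m) - ρ y (ρ x m) = -ρ ⁅x, y⁆ m)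

include hρ

/-- A shadow of the Poincaré–Birkhoff–Witt theorem: moving `z` past a lowering element `y` costs `ρ
⁅z, y⁆` with `⁅z, y⁆` again in `k`. So the vectors that all of `k` sends into the generated space
are closed under lowering elements; on `F` itself, `c` acts by scalars. -/
theorem generated_stable {c : Submodule ℂ L}
    (hk : k.toSubmodule ≤ c ⊔ Submodule.span ℂ (lowering k h))
    (hc : ∀ z ∈ c, ∃ χ : ℂ, ρ z F = χ • F) {z : L} (hz : z ∈ k) {w : M}
    (hw : w ∈ generated ρ k h F) : ρ z w ∈ generated ρ k h F := by
  let S : Submodule ℂ M :=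
    { carrier := {w : M | w ∈ generated ρ k h F ∧ ∀ z ∈ k, ρ z w ∈ generated ρ k h F}
      add_mem' := fun {x y} hx hy => ⟨Submodule.add_mem _ hx.1 hy.1, fun z hz => by
        rw [map_add]; exact Submodule.add_mem _ (hx.2 z hz) (hy.2 z hz)⟩
      zero_mem' := ⟨Submodule.zero_mem _, fun z _ => by
        rw [map_zero]; exact Submodule.zero_mem _⟩
      smul_mem' := fun a x hx => ⟨Submodule.smul_mem _ a hx.1, fun z hz => by
        rw [map_smul]; exact Submodule.smul_mem _ a (hx.2 z hz)⟩ }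
  have hS : generated ρ k h F ≤ S := by
    refine generated_le ⟨mem_generated, fun z hz => ?_⟩ ?_
    · have : c ⊔ Submodule.span ℂ (lowering k h) ≤
          (generated ρ k h F).comap ((LinearMap.applyₗ F) ∘ₗ ρ) := by
        refine sup_le (fun z hz => ?_) (Submodule.span_le.mpr fun y hy => ?_)
        · obtain ⟨χ, hχ⟩ := hc z hz
          change ρ z F ∈ generated ρ k h F
          rw [hχ]
          exact Submodule.smul_mem _ _ mem_generated
        · exact lowering_generated hy mem_generated
      exact this (hk hz)
    · rintro y hy w ⟨hw1, hw2⟩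
      refine ⟨lowering_generated hy hw1, fun z hz => ?_⟩
      have h1 : ρ z (ρ y w) = ρ y (ρ z w) - ρ ⁅z, y⁆ w := by
        rw [sub_eq_add_neg, ← hρ z y w]
        abel
      rw [h1]
      exact sub_mem (lowering_generated hy (hw2 z hz)) (hw2 _ (k.lie_mem hz hy.1))
  exact (hS hw).2 z hz

/-- Because of the minus sign in `hρ`, an element lowered by `h` raises the eigenvalue of `ρ h`. -/
theorem generated_le_eigenspaces {χ : ℂ} (hF : ρ h F = χ • F) :
    generated ρ k h F ≤
      Submodule.span ℂ {F} ⊔ ⨆ n : ℕ, (ρ h).eigenspace (χ + (n + 1)) := by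
  have key : ∀ y (n : ℕ), ⁅h, y⁆ = (-(n + 1) : ℂ) • y → ∀ (μ : ℂ) w, ρ h w = μ • w →
      ρ h (ρ y w) = (μ + (n + 1)) • ρ y w := by
    intro y n hy μ w hw
    have h1 : ρ h (ρ y w) = ρ y (ρ h w) - ρ ⁅h, y⁆ w := by
      rw [sub_eq_add_neg, ← hρ h y w]
      abel
    rw [h1, hw, hy, map_smul, map_smul, LinearMap.smul_apply, ← sub_smul]
    congr 1
    ring
  refine generated_le (Submodule.mem_sup_left (Submodule.mem_span_singleton_self F)) ?_
  rintro y ⟨hy, n, hn⟩ w hw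
  have hle : Submodule.span ℂ {F} ⊔ ⨆ n : ℕ, (ρ h).eigenspace (χ + (n + 1)) ≤
      (⨆ n : ℕ, (ρ h).eigenspace (χ + (n + 1))).comap (ρ y) := by
    refine sup_le ?_ (iSup_le fun m => fun w hw => ?_)
    · rw [Submodule.span_singleton_le_iff_mem]
      exact Submodule.mem_iSup_of_mem n
        (Module.End.mem_eigenspace_iff.mpr (key y n hn χ F hF))
    · refine Submodule.mem_iSup_of_mem (m + n + 1) (Module.End.mem_eigenspace_iff.mpr ?_)
      rw [key y n hn _ w (Module.End.mem_eigenspace_iff.mp hw)]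
      congr 1
      push_cast
      ring
  exact Submodule.mem_sup_right (hle hw)

end Extremal

open Module LieAlgebra

/-! ### The group `K` acting on `𝔤` and on multilinear forms -/

section GroupK

variable {𝔤 : Type*} [LieRing 𝔤] [LieAlgebra ℂ 𝔤] [FiniteDimensional ℂ 𝔤] {θ : 𝔤 ≃ₗ⁅ℂ⁆ 𝔤}

theorem IsExpAd.isExp {x : 𝔤} {u : 𝔤 ≃ₗ[ℂ] 𝔤} (h : IsExpAd x u) :
    IsExp (LieAlgebra.ad ℂ 𝔤 x) (u : 𝔤 →ₗ[ℂ] 𝔤) := h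

theorem exists_isExpAd (x : 𝔤) : ∃ u : 𝔤 ≃ₗ[ℂ] 𝔤, IsExpAd x u :=
  exists_isExp (LieAlgebra.ad ℂ 𝔤 x)

/-- The Lie bracket as a multilinear map. -/
def bracketForm (𝔤 : Type*) [LieRing 𝔤] [LieAlgebra ℂ 𝔤] :
    MultilinearMap ℂ (fun _ : Fin 2 => 𝔤) 𝔤 where
  toFun v := ⁅v 0, v 1⁆
  map_update_add' {inst} v i x y := by
    rw [Subsingleton.elim inst (instDecidableEqFin 2)]
    fin_cases i <;> simp
  map_update_smul' {inst} v i c x := by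
    rw [Subsingleton.elim inst (instDecidableEqFin 2)]
    fin_cases i <;> simp

theorem IsExpAd.lie {x : 𝔤} {u : 𝔤 ≃ₗ[ℂ] 𝔤} (h : IsExpAd x u) (y z : 𝔤) :
    u ⁅y, z⁆ = ⁅u y, u z⁆ := by
  refine h.isExp.apply_multilinear (bracketForm 𝔤) h.isExp (fun v => ?_) ![y, z]
  simp only [bracketForm, MultilinearMap.coe_mk, Fin.sum_univ_two, LieAlgebra.ad_apply]
  have h1 : Function.update v 0 ⁅x, v 0⁆ 1 = v 1 := Function.update_of_ne (by decide) _ _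
  have h2 : Function.update v 1 ⁅x, v 1⁆ 0 = v 0 := Function.update_of_ne (by decide) _ _
  rw [h1, h2, Function.update_self, Function.update_self]
  exact leibniz_lie x (v 0) (v 1)

theorem groupK_lie {u : 𝔤 ≃ₗ[ℂ] 𝔤} (hu : u ∈ groupK θ) (y z : 𝔤) :
    u ⁅y, z⁆ = ⁅u y, u z⁆ := by
  induction hu using Subgroup.closure_induction generalizing y z with
  | mem u hu =>
    obtain ⟨x, -, hx⟩ := hu
    exact hx.lie y z
  | one => rfl
  | mul u v _ _ hu hv =>
    rw [LinearEquiv.mul_apply, LinearEquiv.mul_apply, LinearEquiv.mul_apply, hv, hu]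
  | inv u _ hu =>
    apply u.injective
    rw [hu]
    simp only [← LinearEquiv.mul_apply, mul_inv_cancel]
    rfl

theorem map_symm_le {V : Type*} [AddCommGroup V] [Module ℂ V] [FiniteDimensional ℂ V]
    (e : V ≃ₗ[ℂ] V) {U : Submodule ℂ V} (h : ∀ x ∈ U, e x ∈ U) {x : V} (hx : x ∈ U) :
    e.symm x ∈ U := by
  have h1 : U.map (e : V →ₗ[ℂ] V) ≤ U := Submodule.map_le_iff_le_comap.mpr h
  have h2 : U.map (e : V →ₗ[ℂ] V) = U :=
    Submodule.eq_of_le_of_finrank_eq h1 (LinearEquiv.finrank_map_eq e U)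
  rw [← h2] at hx
  obtain ⟨y, hy, rfl⟩ := hx
  simpa using hy

theorem groupK_apply_mem {U : Submodule ℂ 𝔤}
    (hU : ∀ z ∈ fixedSubalgebra θ, ∀ y ∈ U, ⁅z, y⁆ ∈ U) {u : 𝔤 ≃ₗ[ℂ] 𝔤} (hu : u ∈ groupK θ)
    {y : 𝔤} (hy : y ∈ U) : u y ∈ U := by
  induction hu using Subgroup.closure_induction generalizing y with
  | mem u hu =>
    obtain ⟨x, hx, hxu⟩ := hu
    exact hxu.isExp.apply_mem (hU x hx) hy
  | one => exact hy
  | mul u v _ _ hu hv => exact hu (hv hy)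
  | inv u _ hu => exact map_symm_le u (fun x hx => hu hx) hy

/-- The composition of forms with a linear automorphism. -/
def MForm.compEquiv {E : Type*} [AddCommGroup E] [Module ℂ E] (r : ℕ) (u : E ≃ₗ[ℂ] E) :
    MForm E r ≃ₗ[ℂ] MForm E r where
  toFun F := MForm.comp (u : E →ₗ[ℂ] E) F
  invFun F := MForm.comp (u.symm : E →ₗ[ℂ] E) F
  map_add' _ _ := rfl
  map_smul' _ _ := rfl
  left_inv F := by ext v; simp
  right_inv F := by ext v; simp

theorem groupK_comp_mem {r : ℕ} {U : Submodule ℂ (MForm 𝔤 r)}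
    (hU : ∀ z ∈ fixedSubalgebra θ, ∀ F ∈ U, der (LieAlgebra.ad ℂ 𝔤 z) F ∈ U)
    {u : 𝔤 ≃ₗ[ℂ] 𝔤} (hu : u ∈ groupK θ) {F : MForm 𝔤 r} (hF : F ∈ U) :
    MForm.comp (u : 𝔤 →ₗ[ℂ] 𝔤) F ∈ U := by
  induction hu using Subgroup.closure_induction generalizing F with
  | mem u hu =>
    obtain ⟨x, hx, hxu⟩ := hu
    exact hxu.isExp.comp_mem (hU x hx) hF
  | one => exact hF
  | mul u v _ _ hu hv => exact hv (hu hF)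
  | inv u _ hu => exact map_symm_le (MForm.compEquiv r u) (fun x hx => hu hx) hF

variable (𝔤) in
/-- The action of `𝔤` on multilinear forms by derivations. -/
def derAd (r : ℕ) : 𝔤 →ₗ[ℂ] End ℂ (MForm 𝔤 r) where
  toFun x := der (LieAlgebra.ad ℂ 𝔤 x)
  map_add' x y := by
    ext F : 1
    rw [map_add, der_add]
    rfl
  map_smul' c x := by
    ext F : 1
    rw [map_smul, der_smul]
    rfl

theorem derAd_lie {r : ℕ} (x y : 𝔤) (F : MForm 𝔤 r) :
    derAd 𝔤 r x (derAd 𝔤 r y F) - derAd 𝔤 r y (derAd 𝔤 r x F) = -derAd 𝔤 r ⁅x, y⁆ F := by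
  change der _ (der _ F) - der _ (der _ F) = -der _ F
  have h : LieAlgebra.ad ℂ 𝔤 y * LieAlgebra.ad ℂ 𝔤 x - LieAlgebra.ad ℂ 𝔤 x * LieAlgebra.ad ℂ 𝔤 y =
      (-1 : ℂ) • LieAlgebra.ad ℂ 𝔤 ⁅x, y⁆ := by
    ext z
    simp
  rw [der_der_sub, h, der_smul, neg_one_smul]

/-- Two subalgebras which are conjugate under `K` and whose intersections with `𝔨` have a common
part that is complementary to the elements lowered by some `h` are equal. -/
theorem eq_of_map_eq {B B' : Submodule ℂ 𝔤} (hB : ∀ x ∈ B, ∀ y ∈ B, ⁅x, y⁆ ∈ B)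
    {u : 𝔤 ≃ₗ[ℂ] 𝔤} (hu : u ∈ groupK θ) (hBB' : B' = B.map (u : 𝔤 →ₗ[ℂ] 𝔤)) {h : 𝔤}
    (hh : h ∈ B ⊓ B')
    (hk : (fixedSubalgebra θ).toSubmodule ≤
      (B ⊓ B') ⊔ Submodule.span ℂ (lowering (fixedSubalgebra θ) h)) :
    B = B' := by
  set r := finrank ℂ (𝔤 ⧸ B) with hr
  let F : MForm 𝔤 r := detForm B
  -- `G` is the translate of `F` by `u`, so its kernel is `B'`. The space generated from `F` is
  -- `K`-stable and contains `G`, and conversely with the roles exchanged; hence `G` is a multiple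
  -- of `F`.
  let G : MForm 𝔤 r := MForm.comp (u⁻¹ : 𝔤 ≃ₗ[ℂ] 𝔤) F
  have hinv : ∀ x ∈ B', (u⁻¹ : 𝔤 ≃ₗ[ℂ] 𝔤) x ∈ B := by
    intro x hx
    rw [hBB'] at hx
    obtain ⟨y, hy, rfl⟩ := hx
    change u.symm (u y) ∈ B
    rwa [u.symm_apply_apply]
  have hchF : ∀ z ∈ B, ∃ χ : ℂ, derAd 𝔤 r z F = χ • F := fun z hz =>
    der_detForm (hB z hz)
  have hchG : ∀ z ∈ B', ∃ χ : ℂ, derAd 𝔤 r z G = χ • G := by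
    intro z hz
    obtain ⟨χ, hχ⟩ := hchF _ (hinv z hz)
    refine ⟨χ, ?_⟩
    change der _ (MForm.comp _ F) = _
    rw [der_comp (A' := LieAlgebra.ad ℂ 𝔤 ((u⁻¹ : 𝔤 ≃ₗ[ℂ] 𝔤) z))]
    · change MForm.comp _ (derAd 𝔤 r _ F) = _
      rw [hχ]
      rfl
    · ext y
      exact (groupK_lie (inv_mem hu) z y).symm
  have hG : G ∈ generated (derAd 𝔤 r) (fixedSubalgebra θ) h F :=
    groupK_comp_mem (fun z hz w hw => generated_stable derAd_lie hk
      (fun z hz => hchF z hz.1) hz hw) (inv_mem hu) mem_generated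
  have hFG : F = MForm.comp (u : 𝔤 →ₗ[ℂ] 𝔤) G := by
    ext v
    change F v = F fun i => u.symm (u (v i))
    simp
  have hF : F ∈ generated (derAd 𝔤 r) (fixedSubalgebra θ) h G := by
    have := groupK_comp_mem (F := G) (fun z hz w hw => generated_stable derAd_lie hk
      (fun z hz => hchG z hz.2) hz hw) hu mem_generated
    rwa [← hFG] at this
  obtain ⟨χ, hχ⟩ := hchF h hh.1
  obtain ⟨χ', hχ'⟩ := hchG h hh.2
  have hspan := mem_span_of_extremal hχ hχ' (detForm_ne_zero B)
    (generated_le_eigenspaces derAd_lie hχ hG) (generated_le_eigenspaces derAd_lie hχ' hF)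
  obtain ⟨a, ha⟩ := Submodule.mem_span_singleton.mp hspan
  refine Submodule.eq_of_le_of_finrank_eq ?_ ?_
  · intro w hw
    have h1 : (u⁻¹ : 𝔤 ≃ₗ[ℂ] 𝔤) w ∈ B := by
      refine mem_of_detForm_update fun v i => ?_
      have h2 : G (Function.update (fun j => u (v j)) i w) = 0 := by
        rw [← ha, smul_apply, detForm_update_of_mem hw, smul_zero]
      rw [← h2]
      change F _ = F _
      congr 1
      ext j
      by_cases hj : j = i
      · subst hj; simp
      · simp only [Function.update_of_ne hj]
        exact (u.symm_apply_apply _).symm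
    rw [hBB']
    exact ⟨_, h1, u.apply_symm_apply w⟩
  · rw [hBB']
    exact (LinearEquiv.finrank_map_eq u B).symm

end GroupK

/-! ### Root spaces and the Borel subalgebras containing `𝔱` -/

section RootSpaces

variable {𝔤 : Type*} [LieRing 𝔤] [LieAlgebra ℂ 𝔤] [FiniteDimensional ℂ 𝔤]
  {𝔰 : LieIdeal ℂ 𝔤} [LieAlgebra.IsKilling ℂ 𝔰] {H : LieSubalgebra ℂ 𝔰} [H.IsCartanSubalgebra]

theorem coe_mem_cartan (h : H) : ((h : 𝔰) : 𝔤) ∈ cartan 𝔰 H :=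
  Submodule.mem_sup_left ⟨h.1, h.2, rfl⟩

theorem mem_cartan {t : 𝔤} : t ∈ cartan 𝔰 H ↔
    ∃ (h : H) (z : 𝔤), z ∈ LieAlgebra.center ℂ 𝔤 ∧ ((h : 𝔰) : 𝔤) + z = t := by
  refine Submodule.mem_sup.trans ⟨?_, ?_⟩
  · rintro ⟨-, ⟨h, hh, rfl⟩, z, hz, rfl⟩
    exact ⟨⟨h, hh⟩, z, hz, rfl⟩
  · rintro ⟨h, z, hz, rfl⟩
    exact ⟨_, ⟨h.1, h.2, rfl⟩, z, hz, rfl⟩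

theorem center_lie {z : 𝔤} (hz : z ∈ LieAlgebra.center ℂ 𝔤) (y : 𝔤) : ⁅z, y⁆ = 0 := by
  rw [← lie_skew, (LieModule.mem_maxTrivSubmodule (R := ℂ) (L := 𝔤) (M := 𝔤) z).mp hz y, neg_zero]

theorem cartan_lie_cartan {s t : 𝔤} (hs : s ∈ cartan 𝔰 H) (ht : t ∈ cartan 𝔰 H) :
    ⁅s, t⁆ = 0 := by
  obtain ⟨h, z, hz, rfl⟩ := mem_cartan.mp hs
  obtain ⟨h', z', hz', rfl⟩ := mem_cartan.mp ht
  have h1 : ⁅((h : 𝔰) : 𝔤), ((h' : 𝔰) : 𝔤)⁆ = 0 := by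
    have := trivial_lie_zero H H h h'
    exact congrArg (fun x : H => ((x : 𝔰) : 𝔤)) this
  rw [add_lie, lie_add, h1, center_lie hz, ← lie_skew, center_lie hz']
  simp

theorem exists_of_mem_rootSubspace {α : H.root} {y : 𝔤} (hy : y ∈ rootSubspace α) :
    ∃ y' : 𝔰, y' ∈ LieAlgebra.rootSpace H α.1 ∧ (y' : 𝔤) = y := hy

theorem lie_of_mem_rootSubspace {α : H.root} {y : 𝔤} (hy : y ∈ rootSubspace α) (h : H) :
    ⁅((h : 𝔰) : 𝔤), y⁆ = (IsKilling.rootSystem H).root α h • y := by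
  obtain ⟨y, hym, rfl⟩ := exists_of_mem_rootSubspace hy
  have := IsKilling.lie_eq_smul_of_mem_rootSpace hym h
  exact congrArg (fun x : 𝔰 => (x : 𝔤)) this

theorem exists_lie_of_mem_cartan {t : 𝔤} (ht : t ∈ cartan 𝔰 H) :
    ∃ h : H, (∀ y : 𝔤, ⁅t, y⁆ = ⁅((h : 𝔰) : 𝔤), y⁆) ∧
      ∃ z ∈ LieAlgebra.center ℂ 𝔤, ((h : 𝔰) : 𝔤) + z = t := by
  obtain ⟨h, z, hz, rfl⟩ := mem_cartan.mp ht
  exact ⟨h, fun y => by rw [add_lie, center_lie hz, add_zero], z, hz, rfl⟩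

theorem mem_rootSpace_of_lie {χ : Dual ℂ H} {y : 𝔰} (hy : ∀ h : H, ⁅h, y⁆ = χ h • y) :
    y ∈ LieAlgebra.rootSpace H χ :=
  LieModule.weightSpace_le_genWeightSpace _ _ ((LieModule.mem_weightSpace _ _).mpr hy)

theorem exists_root_ne_zero (α : H.root) : ∃ h : H, (IsKilling.rootSystem H).root α h ≠ 0 := by
  by_contra! hc
  exact (IsKilling.rootSystem H).ne_zero α (LinearMap.ext hc)

/-- A vector with a nonzero eigenvalue under some `h` is a multiple of a bracket with `h`, so it
lies in the ideal `𝔰`. -/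
theorem mem_rootSubspace {α : H.root} {y : 𝔤}
    (hy : ∀ h : H, ⁅((h : 𝔰) : 𝔤), y⁆ = (IsKilling.rootSystem H).root α h • y) : y ∈ rootSubspace α := by
  obtain ⟨h, hh⟩ := exists_root_ne_zero α
  have hys : y ∈ 𝔰 := by
    have h1 : ⁅((h : 𝔰) : 𝔤), y⁆ ∈ 𝔰 := by
      rw [← lie_skew]
      exact neg_mem (𝔰.lie_mem h.1.2)
    rw [hy] at h1
    have h2 := 𝔰.smul_mem ((IsKilling.rootSystem H).root α h)⁻¹ h1
    rwa [smul_smul, inv_mul_cancel₀ hh, one_smul] at h2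
  refine ⟨⟨y, hys⟩, mem_rootSpace_of_lie (χ := (IsKilling.rootSystem H).root α) fun h => ?_, rfl⟩
  exact Subtype.ext (hy h)

theorem exists_ne_zero_mem_rootSubspace (α : H.root) : ∃ y ∈ rootSubspace α, y ≠ 0 := by
  obtain ⟨y, hy, h0⟩ := α.1.exists_ne_zero
  exact ⟨y, ⟨y, hy, rfl⟩, fun h => h0 (Subtype.ext h)⟩

theorem rootSubspace_le_of_mem {α : H.root} {y : 𝔤} (hy : y ∈ rootSubspace α) (h0 : y ≠ 0)
    {U : Submodule ℂ 𝔤} (hU : y ∈ U) : rootSubspace α ≤ U := by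
  rintro - ⟨x, hx, rfl⟩
  obtain ⟨y, hym, rfl⟩ := exists_of_mem_rootSubspace hy
  have h1 := IsKilling.finrank_rootSpace_eq_one α.1 (H.isNonZero_coe_root α)
  have hy0 : (⟨y, hym⟩ : LieAlgebra.rootSpace H α.1) ≠ 0 := by
    intro h
    apply h0
    have : y = 0 := congrArg Subtype.val h
    rw [this]; rfl
  obtain ⟨c, hc⟩ := (finrank_eq_one_iff_of_nonzero' _ hy0).mp h1 ⟨x, hx⟩
  have : x = c • y := (congrArg Subtype.val hc).symm
  rw [this]
  exact U.smul_mem c hU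

theorem cartan_sup_iSup_rootSubspace (h𝔰 : IsCompl 𝔰 (LieAlgebra.center ℂ 𝔤)) :
    cartan 𝔰 H ⊔ ⨆ α : H.root, rootSubspace α = ⊤ := by
  rw [eq_top_iff]
  intro x _
  have hx : x ∈ 𝔰 ⊔ LieAlgebra.center ℂ 𝔤 := by rw [h𝔰.sup_eq_top]; trivial
  obtain ⟨s, hs, z, hz, rfl⟩ := (LieSubmodule.mem_sup _ _ _).mp hx
  refine add_mem ?_ (Submodule.mem_sup_left (Submodule.mem_sup_right hz))
  have h1 : (⊤ : Submodule ℂ 𝔰) ≤ (cartan 𝔰 H ⊔ ⨆ α : H.root, rootSubspace α).comap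
      𝔰.toSubmodule.subtype := by
    have h2 := congrArg LieSubmodule.toSubmodule (LieModule.iSup_genWeightSpace_eq_top' ℂ H 𝔰)
    rw [LieSubmodule.iSup_toSubmodule, LieSubmodule.top_toSubmodule] at h2
    rw [← h2]
    refine iSup_le fun χ y hy => ?_
    by_cases hχ : χ.IsZero
    · refine Submodule.mem_sup_left (Submodule.mem_sup_left ⟨y, ?_, rfl⟩)
      have h3 : y ∈ LieAlgebra.rootSpace H (0 : H → ℂ) := by
        rw [← show (χ : H → ℂ) = 0 from hχ]
        exact hy
      rw [LieAlgebra.rootSpace_zero_eq] at h3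
      exact h3
    · have hr : χ ∈ H.root := by simpa [LieSubalgebra.root] using hχ
      exact Submodule.mem_sup_right (Submodule.mem_iSup_of_mem ⟨χ, hr⟩ ⟨y, hy, rfl⟩)
  exact h1 (x := ⟨s, hs⟩) trivial

theorem lie_rootSubspace {α β : H.root} {y z : 𝔤} (hy : y ∈ rootSubspace α)
    (hz : z ∈ rootSubspace β) (hne : ⁅y, z⁆ ≠ 0) (h0 : (IsKilling.rootSystem H).root α + (IsKilling.rootSystem H).root β ≠ 0) :
    ∃ γ : H.root, (IsKilling.rootSystem H).root γ = (IsKilling.rootSystem H).root α + (IsKilling.rootSystem H).root β ∧ ⁅y, z⁆ ∈ rootSubspace γ := by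
  obtain ⟨y, hym, rfl⟩ := exists_of_mem_rootSubspace hy
  obtain ⟨z, hzm, rfl⟩ := exists_of_mem_rootSubspace hz
  have h1 : ⁅y, z⁆ ∈ LieModule.genWeightSpace 𝔰 (⇑((IsKilling.rootSystem H).root α + (IsKilling.rootSystem H).root β)) :=
    LieAlgebra.lie_mem_genWeightSpace_of_mem_genWeightSpace hym hzm
  have h2 : LieModule.genWeightSpace 𝔰 (⇑((IsKilling.rootSystem H).root α + (IsKilling.rootSystem H).root β)) ≠ ⊥ := by
    intro h
    rw [h, LieSubmodule.mem_bot] at h1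
    apply hne
    exact congrArg (fun x : 𝔰 => (x : 𝔤)) h1
  let χ : LieModule.Weight ℂ H 𝔰 := ⟨⇑((IsKilling.rootSystem H).root α + (IsKilling.rootSystem H).root β), h2⟩
  have hr : χ ∈ H.root := by
    have : ¬ χ.IsZero := fun h => h0 (LinearMap.ext fun x => congr_fun h x)
    simpa [LieSubalgebra.root] using this
  exact ⟨⟨χ, hr⟩, LinearMap.ext fun x => rfl, ⁅y, z⁆, h1, rfl⟩

variable {b : (IsKilling.rootSystem H).Base} {w : Weyl H}

theorem cartan_le_borel : cartan 𝔰 H ≤ borel b w := le_sup_left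

theorem rootSubspace_le_borel {α : H.root} (h : ¬ b.IsPos (w⁻¹ • α)) :
    rootSubspace α ≤ borel b w := by
  have h1 : rootSubspace (w • (w⁻¹ • α)) ≤ borel b w :=
    le_trans (le_iSup₂ (f := fun β (_ : ¬ b.IsPos β) => rootSubspace (w • β)) (w⁻¹ • α) h)
      le_sup_right
  rwa [smul_inv_smul] at h1

theorem borel_le {U : Submodule ℂ 𝔤} (h1 : cartan 𝔰 H ≤ U)
    (h2 : ∀ α : H.root, ¬ b.IsPos (w⁻¹ • α) → rootSubspace α ≤ U) : borel b w ≤ U :=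
  sup_le h1 (iSup₂_le fun α hα => h2 _ (by rwa [inv_smul_smul]))

theorem lie_cartan_rootSubspace {t y : 𝔤} {α : H.root} (ht : t ∈ cartan 𝔰 H)
    (hy : y ∈ rootSubspace α) : ⁅t, y⁆ ∈ rootSubspace α := by
  obtain ⟨h, hh, -⟩ := exists_lie_of_mem_cartan ht
  rw [hh, lie_of_mem_rootSubspace hy]
  exact Submodule.smul_mem _ _ hy

theorem borel_lie_mem {x y : 𝔤} (hx : x ∈ borel b w) (hy : y ∈ borel b w) :
    ⁅x, y⁆ ∈ borel b w := by
  have key : borel b w ≤ (borel b w).comap (LieAlgebra.ad ℂ 𝔤 x) := by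
    have hsk : ∀ u v : 𝔤, ⁅u, v⁆ ∈ borel b w → ⁅v, u⁆ ∈ borel b w := fun u v h => by
      rw [← lie_skew]; exact neg_mem h
    refine borel_le (fun t ht => hsk t x ?_) fun α hα z hz => hsk z x ?_
    · have : borel b w ≤ (borel b w).comap (LieAlgebra.ad ℂ 𝔤 t) := by
        refine borel_le (fun s hs => ?_) fun α hα z hz => ?_
        · change ⁅t, s⁆ ∈ borel b w
          rw [cartan_lie_cartan ht hs]
          exact zero_mem _
        · exact rootSubspace_le_borel hα (lie_cartan_rootSubspace ht hz)
      exact this hx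
    · have : borel b w ≤ (borel b w).comap (LieAlgebra.ad ℂ 𝔤 z) := by
        refine borel_le (fun s hs => ?_) fun β hβ y hy => ?_
        · exact hsk s z (rootSubspace_le_borel hα (lie_cartan_rootSubspace hs hz))
        · change ⁅z, y⁆ ∈ borel b w
          have hsum : ∀ γ : H.root, (IsKilling.rootSystem H).root γ = (IsKilling.rootSystem H).root α + (IsKilling.rootSystem H).root β →
              ¬ b.IsPos (w⁻¹ • γ) := by
            intro γ hγ
            have h1 : (IsKilling.rootSystem H).root (w⁻¹ • γ) = (IsKilling.rootSystem H).root (w⁻¹ • α) + (IsKilling.rootSystem H).root (w⁻¹ • β) := by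
              rw [root_smul, root_smul, root_smul, hγ, smul_add]
            have h2 := b.height_add h1
            unfold RootPairing.Base.IsPos at *
            omega
          by_cases h0 : ⁅z, y⁆ = 0
          · rw [h0]; exact zero_mem _
          by_cases h1 : (IsKilling.rootSystem H).root α + (IsKilling.rootSystem H).root β = 0
          · exfalso
            have h2 : β = reflW (IsKilling.rootSystem H) α • α := (IsKilling.rootSystem H).root.injective (by
              rw [root_reflW_self, eq_neg_iff_add_eq_zero, add_comm]; exact h1)
            rw [h2, isPos_smul_neg] at hβ
            exact hβ hα
          · obtain ⟨γ, hγ, hm⟩ := lie_rootSubspace hz hy h0 h1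
            exact rootSubspace_le_borel (hsum γ hγ) hm
      exact this hx
  exact key hy

/-- An element of the Cartan subalgebra whose eigenvalues on the root spaces are the heights
relative to the base `w • b`. -/
theorem exists_height (b : (IsKilling.rootSystem H).Base) (w : Weyl H) :
    ∃ h : H, ∀ α : H.root, (IsKilling.rootSystem H).root α h = -(b.height (w⁻¹ • α) : ℂ) := by
  -- The value is `-1` on simple roots because `borel b w` is built from negative roots: the root
  -- spaces outside it then have negative eigenvalues.
  let φ : Dual ℂ (Dual ℂ H) := b.toWeightBasis.constr ℂ fun _ => (-1 : ℂ)
  have hφ : ∀ α : H.root, φ ((IsKilling.rootSystem H).root α) = -(b.height α : ℂ) := by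
    intro α
    obtain ⟨f, -, -, hf⟩ := b.exists_root_eq_sum_int α
    have h1 : ∀ j ∈ b.support, φ ((IsKilling.rootSystem H).root j) = -1 := fun j hj => by
      rw [← b.toWeightBasis_apply ⟨j, hj⟩]
      exact b.toWeightBasis.constr_basis ℂ _ _
    rw [b.height_eq_sum hf, hf, map_sum, Int.cast_sum, ← Finset.sum_neg_distrib]
    refine Finset.sum_congr rfl fun j hj => ?_
    rw [map_zsmul, h1 j hj]
    simp
  let ψ : Dual ℂ (Dual ℂ H) :=
    { toFun := fun m => φ (w⁻¹ • m)
      map_add' := fun m m' => by rw [smul_add, map_add]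
      map_smul' := fun a m => by rw [weyl_smul_smul, map_smul]; rfl }
  refine ⟨(Module.evalEquiv ℂ H).symm ψ, fun α => ?_⟩
  rw [Module.apply_evalEquiv_symm_apply]
  change φ (w⁻¹ • (IsKilling.rootSystem H).root α) = _
  rw [← root_smul, hφ]

theorem lie_height {h : H} (hh : ∀ α : H.root, (IsKilling.rootSystem H).root α h = -(b.height (w⁻¹ • α) : ℂ))
    {α : H.root} {y : 𝔤} (hy : y ∈ rootSubspace α) :
    ⁅((h : 𝔰) : 𝔤), y⁆ = -(b.height (w⁻¹ • α) : ℂ) • y := by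
  rw [lie_of_mem_rootSubspace hy, hh]

/-- On `borel b w` the height element has only nonnegative eigenvalues, whereas a root made positive
by `w⁻¹` has a negative one. -/
theorem not_isPos_of_rootSubspace_le {α : H.root} (hα : rootSubspace α ≤ borel b w) :
    ¬ b.IsPos (w⁻¹ • α) := by
  intro hpos
  obtain ⟨h, hh⟩ := exists_height b w
  obtain ⟨y, hy, hy0⟩ := exists_ne_zero_mem_rootSubspace α
  let A := LieAlgebra.ad ℂ 𝔤 ((h : 𝔰) : 𝔤)
  have hpos' : (0 : ℤ) < b.height (w⁻¹ • α) := hpos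
  have hd := (Module.End.eigenspaces_iSupIndep A) (-(b.height (w⁻¹ • α) : ℂ))
  have h1 : borel b w ≤ ⨆ μ : ℂ, ⨆ _ : μ ≠ -(b.height (w⁻¹ • α) : ℂ), A.eigenspace μ := by
    refine borel_le (fun t ht => ?_) fun β hβ z hz => ?_
    · refine Submodule.mem_iSup_of_mem 0 (Submodule.mem_iSup_of_mem ?_ ?_)
      · rw [ne_eq, zero_eq_neg]
        exact_mod_cast hpos'.ne'
      · rw [Module.End.mem_eigenspace_iff, zero_smul]
        exact cartan_lie_cartan (coe_mem_cartan h) ht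
    · refine Submodule.mem_iSup_of_mem (-(b.height (w⁻¹ • β) : ℂ))
        (Submodule.mem_iSup_of_mem ?_ ?_)
      · intro he
        have he' : b.height (w⁻¹ • β) = b.height (w⁻¹ • α) := by exact_mod_cast neg_injective he
        exact hβ (show 0 < b.height _ by rw [he']; exact hpos')
      · rw [Module.End.mem_eigenspace_iff]
        exact lie_height hh hz
  refine hy0 ((Submodule.disjoint_def.mp hd) y ?_ (h1 (hα hy)))
  rw [Module.End.mem_eigenspace_iff]
  exact lie_height hh hy

theorem eq_one_of_forall_isPos {v : Weyl H} (h : ∀ α : H.root, b.IsPos α → b.IsPos (v⁻¹ • α)) :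
    v = 1 := by
  have h0 : invCount b Set.univ v = 0 := by
    have : inversions b Set.univ v = ∅ :=
      Set.eq_empty_iff_forall_notMem.mpr fun i hi => hi.2.2 (h i hi.2.1)
    rw [invCount, this, Set.ncard_empty]
  rw [← sInf_word_length] at h0
  obtain ⟨L, h1, h2⟩ := exists_word b v
  -- An infimum equal to zero could also come from an empty set of words, which `exists_word`
  -- excludes.
  rcases Nat.sInf_eq_zero.mp h0 with ⟨L', -, h4, h5⟩ | h3
  · rw [List.length_eq_zero_iff.mp h5] at h4
    exact h4.symm
  · exact (Set.eq_empty_iff_forall_notMem.mp h3 L.length ⟨L, h1, h2, rfl⟩).elim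

theorem eq_of_borel_eq {w w' : Weyl H} (h : borel b w = borel b w') : w = w' := by
  have key : w'⁻¹ * w = 1 := by
    refine inv_injective ?_
    rw [inv_one]
    refine eq_one_of_forall_isPos (b := b) fun α hα => ?_
    by_contra hc
    rw [inv_inv, mul_smul] at hc
    have h1 : rootSubspace (w • α) ≤ borel b w' := rootSubspace_le_borel hc
    rw [← h] at h1
    have h2 := not_isPos_of_rootSubspace_le h1
    rw [inv_smul_smul] at h2
    exact h2 hα
  exact (inv_mul_eq_one.mp key).symm

end RootSpaces

/-! ### Compact roots, and their reflections realised in `K` -/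

section Compact

variable {𝔤 : Type*} [LieRing 𝔤] [LieAlgebra ℂ 𝔤] [FiniteDimensional ℂ 𝔤]
  {𝔰 : LieIdeal ℂ 𝔤} [LieAlgebra.IsKilling ℂ 𝔰] {H : LieSubalgebra ℂ 𝔰} [H.IsCartanSubalgebra]
  {θ : 𝔤 ≃ₗ⁅ℂ⁆ 𝔤}

theorem mem_fixedSubalgebra {x : 𝔤} : x ∈ fixedSubalgebra θ ↔ θ x = x := Iff.rfl

theorem isCompactRoot_of_mem {α : H.root} {y : 𝔤} (hy : y ∈ rootSubspace α) (h0 : y ≠ 0)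
    (hk : y ∈ fixedSubalgebra θ) : IsCompactRoot θ α := rootSubspace_le_of_mem hy h0 hk

theorem add_map_mem (hθ : ∀ x, θ (θ x) = x) (x : 𝔤) : x + θ x ∈ fixedSubalgebra θ := by
  rw [mem_fixedSubalgebra, map_add, hθ, add_comm]

theorem map_mem_rootSubspace (hH : cartan 𝔰 H ≤ (fixedSubalgebra θ).toSubmodule)
    {α : H.root} {y : 𝔤} (hy : y ∈ rootSubspace α) :
    θ y ∈ rootSubspace α := by
  refine mem_rootSubspace fun h => ?_
  have h1 : θ ((h : 𝔰) : 𝔤) = ((h : 𝔰) : 𝔤) := hH (coe_mem_cartan h)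
  conv_lhs => rw [← h1]
  rw [← LieEquiv.map_lie, lie_of_mem_rootSubspace hy, map_smul]

/-- The map `x ↦ x + θ x` is twice the projection onto `𝔨`, and `θ` preserves each root line. So the
image of a root line is zero unless the root is compact. -/
theorem fixedSubalgebra_le (hθ : ∀ x, θ (θ x) = x)
    (hH : cartan 𝔰 H ≤ (fixedSubalgebra θ).toSubmodule) (h𝔰 : IsCompl 𝔰 (LieAlgebra.center ℂ 𝔤)) :
    (fixedSubalgebra θ).toSubmodule ≤
      cartan 𝔰 H ⊔ ⨆ α : H.root, ⨆ _ : IsCompactRoot θ α, rootSubspace α := by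
  set U := cartan 𝔰 H ⊔ ⨆ α : H.root, ⨆ _ : IsCompactRoot θ α, rootSubspace α with hU
  have key : (⊤ : Submodule ℂ 𝔤) ≤
      U.comap (LinearMap.id + (θ : 𝔤 →ₗ[ℂ] 𝔤)) := by
    rw [← cartan_sup_iSup_rootSubspace (H := H) h𝔰]
    refine sup_le (fun t ht => ?_) (iSup_le fun α y hy => ?_)
    · change t + θ t ∈ U
      rw [show θ t = t from hH ht]
      exact Submodule.mem_sup_left (add_mem ht ht)
    · change y + θ y ∈ U
      by_cases h0 : y + θ y = 0
      · rw [h0]; exact zero_mem _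
      · have hm : y + θ y ∈ rootSubspace α := add_mem hy (map_mem_rootSubspace hH hy)
        have hc := isCompactRoot_of_mem hm h0 (add_map_mem hθ y)
        exact Submodule.mem_sup_right (Submodule.mem_iSup_of_mem α
          (Submodule.mem_iSup_of_mem hc hm))
  intro x hx
  have h1 : x + θ x ∈ U := key (x := x) trivial
  rw [show θ x = x from hx, ← two_smul ℂ x] at h1
  have h2 := U.smul_mem (2⁻¹ : ℂ) h1
  rwa [smul_smul, inv_mul_cancel₀ two_ne_zero, one_smul] at h2

/-- An `sl₂`-triple in `𝔨` attached to a compact root. -/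
theorem exists_sl2 (hθ : ∀ x, θ (θ x) = x) (hH : cartan 𝔰 H ≤ (fixedSubalgebra θ).toSubmodule)
    {δ : H.root} (hδ : IsCompactRoot θ δ) :
    ∃ e f : 𝔤, e ∈ fixedSubalgebra θ ∧ f ∈ fixedSubalgebra θ ∧
      ⁅e, f⁆ = (((IsKilling.rootSystem H).coroot δ : 𝔰) : 𝔤) ∧
      (∀ h : H, ⁅((h : 𝔰) : 𝔤), e⁆ = (IsKilling.rootSystem H).root δ h • e) ∧
      (∀ h : H, ⁅((h : 𝔰) : 𝔤), f⁆ = -((IsKilling.rootSystem H).root δ h) • f) := by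
  obtain ⟨h, e, f, ht, he, hf⟩ :=
    IsKilling.exists_isSl2Triple_of_weight_isNonZero (H.isNonZero_coe_root δ)
  have hh := ht.h_eq_coroot (H.isNonZero_coe_root δ) he hf
  have heδ : (e : 𝔤) ∈ rootSubspace δ := ⟨e, he, rfl⟩
  have hef : ⁅(e : 𝔤), (f : 𝔤)⁆ = (((IsKilling.rootSystem H).coroot δ : 𝔰) : 𝔤) := by
    have h1 : ⁅e, f⁆ = ((IsKilling.rootSystem H).coroot δ : 𝔰) := ht.lie_e_f.trans hh
    exact congrArg (fun x : 𝔰 => (x : 𝔤)) h1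
  have hfw : ∀ h : H, ⁅((h : 𝔰) : 𝔤), (f : 𝔤)⁆ = -((IsKilling.rootSystem H).root δ h) • (f : 𝔤) := by
    intro h
    have := IsKilling.lie_eq_smul_of_mem_rootSpace hf h
    exact congrArg (fun x : 𝔰 => (x : 𝔤)) this
  have hfδ : (f : 𝔤) ∈ rootSubspace (reflW (IsKilling.rootSystem H) δ • δ) := by
    refine mem_rootSubspace fun h => ?_
    rw [hfw, root_reflW_self]
    rfl
  refine ⟨e, f, hδ heδ, ?_, hef, lie_of_mem_rootSubspace heδ, hfw⟩
  -- If `θ f = -f`, then `θ` would negate `⁅e, f⁆`, the coroot; but that lies in `𝔱` and is fixed.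
  -- Otherwise `f + θ f` is a nonzero fixed vector on the line of `f`.
  by_cases h0 : (f : 𝔤) + θ f = 0
  · exfalso
    have h1 : θ ⁅(e : 𝔤), (f : 𝔤)⁆ = ⁅(e : 𝔤), (f : 𝔤)⁆ := by
      rw [hef]
      exact hH (coe_mem_cartan _)
    rw [LieEquiv.map_lie, show θ (e : 𝔤) = e from hδ heδ, ← neg_eq_of_add_eq_zero_right h0,
      lie_neg, hef, neg_eq_iff_add_eq_zero, ← two_smul ℂ] at h1
    have h2 := (smul_eq_zero.mp h1).resolve_left two_ne_zero
    apply (IsKilling.rootSystem H).flip.ne_zero δ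
    exact Subtype.ext (Subtype.ext h2)
  · exact isCompactRoot_of_mem (add_mem hfδ (map_mem_rootSubspace hH hfδ)) h0
      (add_map_mem hθ _) hfδ

/-- The reflection in a compact root is induced by an element of `K`. -/
theorem exists_implement (hθ : ∀ x, θ (θ x) = x)
    (hH : cartan 𝔰 H ≤ (fixedSubalgebra θ).toSubmodule) {δ : H.root} (hδ : IsCompactRoot θ δ) :
    ∃ u ∈ groupK θ, (∀ z ∈ LieAlgebra.center ℂ 𝔤, u z = z) ∧
      ∀ h : H, u ((h : 𝔰) : 𝔤) = ((h : 𝔰) : 𝔤) - (IsKilling.rootSystem H).root δ h •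
        (((IsKilling.rootSystem H).coroot δ : 𝔰) : 𝔤) := by
  -- The reflection is lifted as `exp(e) exp(-f) exp(e)`, as in `SL₂`. On the vectors needed below,
  -- the exponential series stop at the quadratic term.
  obtain ⟨e, f, hek, hfk, hef, he, hf⟩ := exists_sl2 hθ hH hδ
  obtain ⟨u, hu⟩ := exists_isExpAd e
  obtain ⟨v, hv⟩ := exists_isExpAd (-f)
  set c : 𝔤 := (((IsKilling.rootSystem H).coroot δ : 𝔰) : 𝔤) with hc
  have hδc : (IsKilling.rootSystem H).root δ ((IsKilling.rootSystem H).coroot δ) = 2 :=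
    (IsKilling.rootSystem H).root_coroot_two δ
  have hce : ⁅c, e⁆ = (2 : ℂ) • e := by rw [hc, he, hδc]
  have hcf : ⁅c, f⁆ = -(2 : ℂ) • f := by rw [hc, hf, hδc]
  have heh : ∀ h : H, ⁅e, ((h : 𝔰) : 𝔤)⁆ = -((IsKilling.rootSystem H).root δ h • e) := fun h => by
    rw [← lie_skew, he]
  have hfh : ∀ h : H, ⁅f, ((h : 𝔰) : 𝔤)⁆ = (IsKilling.rootSystem H).root δ h • f := fun h => by
    rw [← lie_skew, hf, neg_smul, neg_neg]
  have hec : ⁅e, c⁆ = -((2 : ℂ) • e) := by rw [hc, heh, hδc]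
  have hfc : ⁅f, c⁆ = (2 : ℂ) • f := by rw [hc, hfh, hδc]
  have hfe : ⁅f, e⁆ = -c := by rw [← lie_skew, hef]
  have hu0 : u e = e := by
    have := hu.isExp.apply_eq (y := e) (by simp)
    simpa using this
  have huh : ∀ h : H, u ((h : 𝔰) : 𝔤) = ((h : 𝔰) : 𝔤) - (IsKilling.rootSystem H).root δ h • e := by
    intro h
    have := hu.isExp.apply_eq (y := ((h : 𝔰) : 𝔤)) (by simp [heh])
    simpa [heh, sub_eq_add_neg] using this
  have hvh : ∀ h : H, v ((h : 𝔰) : 𝔤) = ((h : 𝔰) : 𝔤) - (IsKilling.rootSystem H).root δ h • f := by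
    intro h
    have := hv.isExp.apply_eq (y := ((h : 𝔰) : 𝔤)) (by simp [hfh])
    simpa [hfh, sub_eq_add_neg] using this
  have hve : v e = e + c - f := by
    have := hv.isExp.apply_eq (y := e) (by simp [hfe, hfc])
    simpa [hfe, hfc, sub_eq_add_neg] using this
  have huf : u f = f + c - e := by
    have := hu.isExp.apply_eq (y := f) (by simp [hef, hec])
    simpa [hef, hec, sub_eq_add_neg] using this
  have huc : u c = c - (2 : ℂ) • e := by rw [hc, huh, hδc]
  have hcen : ∀ z ∈ LieAlgebra.center ℂ 𝔤, ∀ y : 𝔤, ⁅y, z⁆ = 0 := fun z hz y => by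
    rw [← lie_skew, center_lie hz, neg_zero]
  refine ⟨u * v * u, mul_mem (mul_mem (Subgroup.subset_closure ⟨e, hek, hu⟩)
    (Subgroup.subset_closure ⟨-f, neg_mem hfk, hv⟩)) (Subgroup.subset_closure ⟨e, hek, hu⟩),
    fun z hz => ?_, fun h => ?_⟩
  · have h1 : u z = z := by
      have := hu.isExp.apply_eq (y := z) (by simp [hcen z hz])
      simpa [hcen z hz] using this
    have h2 : v z = z := by
      have := hv.isExp.apply_eq (y := z) (by simp [hcen z hz])
      simpa [hcen z hz] using this
    rw [LinearEquiv.mul_apply, LinearEquiv.mul_apply, h1, h2, h1]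
  · rw [LinearEquiv.mul_apply, LinearEquiv.mul_apply, huh, map_sub, map_smul, hvh, hve]
    simp only [map_sub, map_smul, map_add, huh, huf, huc, hu0]
    module

end Compact

/-! ### Conjugacy under `K` of the Borel subalgebras containing `𝔱` -/

section Conjugacy

variable {𝔤 : Type*} [LieRing 𝔤] [LieAlgebra ℂ 𝔤] [FiniteDimensional ℂ 𝔤]
  {𝔰 : LieIdeal ℂ 𝔤} [LieAlgebra.IsKilling ℂ 𝔰] {H : LieSubalgebra ℂ 𝔰} [H.IsCartanSubalgebra]
  {θ : 𝔤 ≃ₗ⁅ℂ⁆ 𝔤} {b : (IsKilling.rootSystem H).Base}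

theorem exists_map_borel (hθ : ∀ x, θ (θ x) = x)
    (hH : cartan 𝔰 H ≤ (fixedSubalgebra θ).toSubmodule) {δ : H.root} (hδ : IsCompactRoot θ δ) :
    ∃ u ∈ groupK θ, (∀ α : H.root, ∀ y ∈ rootSubspace α,
        u y ∈ rootSubspace (reflW (IsKilling.rootSystem H) δ • α)) ∧
      ∀ (b : (IsKilling.rootSystem H).Base) (w : Weyl H),
        (borel b w).map (u : 𝔤 →ₗ[ℂ] 𝔤) = borel b (reflW (IsKilling.rootSystem H) δ * w) := by
  obtain ⟨u, hu, hz, hh⟩ := exists_implement hθ hH hδ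
  have hroot : ∀ α : H.root, ∀ y ∈ rootSubspace α,
      u y ∈ rootSubspace (reflW (IsKilling.rootSystem H) δ • α) := by
    intro α y hy
    refine mem_rootSubspace fun h => ?_
    let h' : H := h - (IsKilling.rootSystem H).root δ h • (IsKilling.rootSystem H).coroot δ
    have h2 : (IsKilling.rootSystem H).root δ ((IsKilling.rootSystem H).coroot δ) = 2 :=
      (IsKilling.rootSystem H).root_coroot_two δ
    have h1 : u ((h' : 𝔰) : 𝔤) = ((h : 𝔰) : 𝔤) := by
      rw [hh h', map_sub, map_smul, h2]
      change ((h : 𝔰) : 𝔤) - (IsKilling.rootSystem H).root δ h •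
        (((IsKilling.rootSystem H).coroot δ : 𝔰) : 𝔤) - _ = _
      rw [smul_eq_mul]
      module
    conv_lhs => rw [← h1]
    rw [← groupK_lie hu, lie_of_mem_rootSubspace hy, map_smul]
    congr 1
    rw [map_sub, map_smul, reflW_smul, RootPairing.root_reflectionPerm,
      RootPairing.reflection_apply, smul_eq_mul, mul_comm]
    rfl
  have hle : ∀ (b : (IsKilling.rootSystem H).Base) (w : Weyl H),
      (borel b w).map (u : 𝔤 →ₗ[ℂ] 𝔤) ≤ borel b (reflW (IsKilling.rootSystem H) δ * w) := by
    intro b w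
    rw [Submodule.map_le_iff_le_comap]
    refine borel_le (fun t ht => ?_) fun α hα y hy => ?_
    · obtain ⟨h, -, z, hzc, rfl⟩ := exists_lie_of_mem_cartan ht
      change u _ ∈ borel b (reflW (IsKilling.rootSystem H) δ * w)
      rw [map_add, hz z hzc, hh]
      exact cartan_le_borel (add_mem (sub_mem (coe_mem_cartan h)
        (Submodule.smul_mem _ _ (coe_mem_cartan _))) (Submodule.mem_sup_right hzc))
    · refine rootSubspace_le_borel ?_ (hroot α y hy)
      rwa [reflW_mul_inv_smul, reflW_smul_cancel]
  -- The inclusion compares dimensions for `w` and for `s_δ w` alike; as `s_δ` is an involution, the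
  -- dimensions agree.
  have hrank : ∀ (b : (IsKilling.rootSystem H).Base) (w : Weyl H), finrank ℂ (borel b w) ≤
      finrank ℂ (borel b (reflW (IsKilling.rootSystem H) δ * w)) := fun b w => by
    have := Submodule.finrank_mono (hle b w)
    rwa [LinearEquiv.finrank_map_eq] at this
  refine ⟨u, hu, hroot, fun b w => Submodule.eq_of_le_of_finrank_le (hle b w) ?_⟩
  have := hrank b (reflW (IsKilling.rootSystem H) δ * w)
  rw [reflW_mul_cancel] at this
  rwa [LinearEquiv.finrank_map_eq]

/-- The element of `K` realising `s_δ` preserves `𝔨` and carries the root space of `α` into that of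
`s_δ α`. -/
theorem isReflClosed_compact (hθ : ∀ x, θ (θ x) = x)
    (hH : cartan 𝔰 H ≤ (fixedSubalgebra θ).toSubmodule) :
    IsReflClosed (IsKilling.rootSystem H) {α : H.root | IsCompactRoot θ α} := by
  intro δ hδ α hα
  obtain ⟨u, hu, hroot, -⟩ := exists_map_borel hθ hH hδ
  obtain ⟨y, hy, hy0⟩ := exists_ne_zero_mem_rootSubspace α
  refine isCompactRoot_of_mem (hroot α y hy) (fun h => hy0 ?_)
    (groupK_apply_mem (U := (fixedSubalgebra θ).toSubmodule)
      (fun z hz x hx => (fixedSubalgebra θ).lie_mem hz hx) hu (hα hy))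
  exact (LinearEquiv.map_eq_zero_iff u).mp h

/-- The Borel subalgebras containing the Cartan subalgebra which are conjugate under `K` are
separated by the compact roots. -/
theorem eq_of_map_borel_eq (h𝔰 : IsCompl 𝔰 (LieAlgebra.center ℂ 𝔤)) (hθ : ∀ x, θ (θ x) = x)
    (hH : cartan 𝔰 H ≤ (fixedSubalgebra θ).toSubmodule) {w w' : Weyl H} {u : 𝔤 ≃ₗ[ℂ] 𝔤}
    (hu : u ∈ groupK θ) (h : borel b w' = (borel b w).map (u : 𝔤 →ₗ[ℂ] 𝔤))
    (hc : ∀ α : H.root, IsCompactRoot θ α → (b.IsPos (w⁻¹ • α) ↔ b.IsPos (w'⁻¹ • α))) :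
    w = w' := by
  obtain ⟨t, ht⟩ := exists_height b w
  -- Each compact root space either lies in both Borel subalgebras or is lowered by the height
  -- element `t`.
  refine eq_of_borel_eq (eq_of_map_eq (fun x hx y hy => borel_lie_mem hx hy) hu h
    (h := ((t : 𝔰) : 𝔤)) ⟨cartan_le_borel (coe_mem_cartan t), cartan_le_borel (coe_mem_cartan t)⟩
    ((fixedSubalgebra_le hθ hH h𝔰).trans (sup_le ?_ (iSup₂_le fun α hα => ?_))))
  · exact le_sup_of_le_left (le_inf cartan_le_borel cartan_le_borel)
  · by_cases hp : b.IsPos (w⁻¹ • α)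
    · refine le_sup_of_le_right fun y hy => Submodule.subset_span ⟨hα hy, ?_⟩
      obtain ⟨n, hn⟩ := Int.eq_succ_of_zero_lt (show 0 < b.height (w⁻¹ • α) from hp)
      refine ⟨n, ?_⟩
      rw [lie_height ht hy, hn]
      push_cast
      rfl
    · exact le_sup_of_le_left (le_inf (rootSubspace_le_borel hp)
        (rootSubspace_le_borel (by rwa [← hc α hα])))

/-- The group generated by the reflections in the compact roots. -/
noncomputable def compactWeyl (H : LieSubalgebra ℂ 𝔰) [H.IsCartanSubalgebra] (θ : 𝔤 ≃ₗ⁅ℂ⁆ 𝔤) :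
    Subgroup (Weyl H) :=
  Subgroup.closure {v | ∃ δ : H.root, IsCompactRoot θ δ ∧ v = reflW (IsKilling.rootSystem H) δ}

theorem exists_map_borel_of_mem_compactWeyl (hθ : ∀ x, θ (θ x) = x)
    (hH : cartan 𝔰 H ≤ (fixedSubalgebra θ).toSubmodule) {v : Weyl H}
    (hv : v ∈ compactWeyl H θ) (b : (IsKilling.rootSystem H).Base) (w : Weyl H) :
    ∃ u ∈ groupK θ, (borel b w).map (u : 𝔤 →ₗ[ℂ] 𝔤) = borel b (v * w) := by
  induction hv using Subgroup.closure_induction generalizing w with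
  | mem v hv =>
    obtain ⟨δ, hδ, rfl⟩ := hv
    obtain ⟨u, hu, -, h⟩ := exists_map_borel hθ hH hδ
    exact ⟨u, hu, h b w⟩
  | one => exact ⟨1, one_mem _, by rw [one_mul]; exact Submodule.map_id _⟩
  | mul v v' _ _ h h' =>
    obtain ⟨u', hu', e'⟩ := h' w
    obtain ⟨u, hu, e⟩ := h (v' * w)
    refine ⟨u * u', mul_mem hu hu', ?_⟩
    rw [mul_assoc, ← e, ← e', ← Submodule.map_comp]
    rfl
  | inv v _ h =>
    obtain ⟨u, hu, e⟩ := h (v⁻¹ * w)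
    refine ⟨u⁻¹, inv_mem hu, ?_⟩
    rw [mul_inv_cancel_left] at e
    rw [← e, ← Submodule.map_comp]
    have : ((u⁻¹ : 𝔤 ≃ₗ[ℂ] 𝔤) : 𝔤 →ₗ[ℂ] 𝔤) ∘ₗ (u : 𝔤 →ₗ[ℂ] 𝔤) = LinearMap.id :=
      LinearMap.ext fun x => u.symm_apply_apply x
    rw [this, Submodule.map_id]

/-- As long as `w` has a compact inversion, some simple reflection of the compact system removes
one. At the end `(v * w)⁻¹` preserves the signs of all compact roots. -/
theorem exists_mem_compactWeyl (hθ : ∀ x, θ (θ x) = x)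
    (hH : cartan 𝔰 H ≤ (fixedSubalgebra θ).toSubmodule) (b : (IsKilling.rootSystem H).Base)
    (w : Weyl H) : ∃ v ∈ compactWeyl H θ, ∀ α : H.root, IsCompactRoot θ α →
      (b.IsPos ((v * w)⁻¹ • α) ↔ b.IsPos α) := by
  have hcl := isReflClosed_compact hθ hH
  induction hn : invCount b {α : H.root | IsCompactRoot θ α} w using Nat.strong_induction_on
    generalizing w with
  | _ n ih =>
  by_cases h0 : invCount b {α : H.root | IsCompactRoot θ α} w = 0
  · refine ⟨1, one_mem _, ?_⟩
    have hpos : ∀ α : H.root, IsCompactRoot θ α → b.IsPos α → b.IsPos (w⁻¹ • α) := by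
      intro α hα hp
      by_contra hc
      exact (Set.eq_empty_iff_forall_notMem.mp ((Set.ncard_eq_zero).mp h0) α) ⟨hα, hp, hc⟩
    intro α hα
    rw [one_mul]
    refine ⟨fun h => ?_, hpos α hα⟩
    by_contra hn
    rw [← isPos_neg] at hn
    have := hpos _ (hcl _ hα _ hα) hn
    rw [isPos_smul_neg] at this
    exact this h
  · obtain ⟨a, ha, hna⟩ := exists_descent hcl h0
    obtain ⟨v, hv, h⟩ := ih _ (by rw [← hn]; exact invCount_gt hcl ha.1 ha.2.1 hna)
      (reflW (IsKilling.rootSystem H) a * w) rfl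
    refine ⟨v * reflW (IsKilling.rootSystem H) a,
      mul_mem hv (Subgroup.subset_closure ⟨a, ha.1, rfl⟩), ?_⟩
    rwa [mul_assoc]

theorem isPos_reflW_iff {ι R M N : Type*} [Field R] [CharZero R] [AddCommGroup M] [Module R M]
    [AddCommGroup N] [Module R N] {P : RootPairing ι R M N} [P.IsCrystallographic] [P.IsReduced]
    [Finite ι] {b : P.Base} {a j : ι} (ha : a ∈ b.support) (h1 : j ≠ a) (h2 : j ≠ reflW P a • a) :
    b.IsPos (reflW P a • j) ↔ b.IsPos j := by
  have hs := (isSimpleIn_univ (b := b) ha).2.2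
  refine ⟨fun h => ?_, fun h => hs j trivial h h1⟩
  by_contra hn
  rw [← isPos_neg] at hn
  have := hs _ trivial hn fun h => h2 (by rw [← h, reflW_neg, reflW_smul_cancel])
  rw [isPos_smul_neg] at this
  exact this h

/-- If both `y` and `s_α y` give Borel subalgebras in the same `K`-orbit, then `α` is compact. -/
theorem isCompactRoot_of_mem_setA (h𝔰 : IsCompl 𝔰 (LieAlgebra.center ℂ 𝔤))
    (hθ : ∀ x, θ (θ x) = x) (hH : cartan 𝔰 H ≤ (fixedSubalgebra θ).toSubmodule)
    {Q : Set (Submodule ℂ 𝔤)} (hQ : IsOrbit θ Q) {y : Weyl H} {α : H.root}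
    (hx : reflW (IsKilling.rootSystem H) α * y ∈ setA b Q) (hy : y ∈ setA b Q) :
    IsCompactRoot θ α := by
  have hcl := isReflClosed_compact hθ hH
  have hmap : ∀ (U : Submodule ℂ 𝔤) (u v : 𝔤 ≃ₗ[ℂ] 𝔤),
      (U.map (v : 𝔤 →ₗ[ℂ] 𝔤)).map (u : 𝔤 →ₗ[ℂ] 𝔤) = U.map ((u * v : 𝔤 ≃ₗ[ℂ] 𝔤) : 𝔤 →ₗ[ℂ] 𝔤) :=
    fun U u v => (Submodule.map_comp _ _ _).symm
  -- Both elements are normalised by compact reflections so that no compact inversions remain. The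
  -- resulting Borel subalgebras are still `K`-conjugate, hence equal, which writes `s_α` as a
  -- product of compact reflections.
  have hmem : reflW (IsKilling.rootSystem H) α ∈ compactWeyl H θ := by
    obtain ⟨B, -, rfl⟩ := hQ
    obtain ⟨u₁, hu₁, e₁⟩ := hx
    obtain ⟨u₂, hu₂, e₂⟩ := hy
    obtain ⟨v₁, hv₁, k₁⟩ := exists_mem_compactWeyl hθ hH b (reflW (IsKilling.rootSystem H) α * y)
    obtain ⟨v₂, hv₂, k₂⟩ := exists_mem_compactWeyl hθ hH b y
    obtain ⟨c₁, hc₁, g₁⟩ := exists_map_borel_of_mem_compactWeyl hθ hH hv₁ b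
      (reflW (IsKilling.rootSystem H) α * y)
    obtain ⟨c₂, hc₂, g₂⟩ := exists_map_borel_of_mem_compactWeyl hθ hH hv₂ b y
    have heq : v₁ * (reflW (IsKilling.rootSystem H) α * y) = v₂ * y := by
      refine eq_of_map_borel_eq (b := b) h𝔰 hθ hH (u := c₂ * u₂ * (c₁ * u₁)⁻¹)
        (mul_mem (mul_mem hc₂ hu₂) (inv_mem (mul_mem hc₁ hu₁))) ?_ fun β hβ => ?_
      · rw [← g₁, ← g₂, e₁, e₂, hmap _ c₂, hmap _ c₁, hmap, inv_mul_cancel_right]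
      · rw [k₁ β hβ, k₂ β hβ]
    rw [← mul_assoc] at heq
    have : reflW (IsKilling.rootSystem H) α = v₁⁻¹ * v₂ := by
      rw [eq_inv_mul_iff_mul_eq]
      exact mul_right_cancel heq
    rw [this]
    exact mul_mem (inv_mem hv₁) hv₂
  by_contra hα
  -- Write `α = w a` with `a` simple. Then `s_α w = w s_a` and `w` give different signs only to
  -- `±α`. If `α` were not compact, they would agree on compact roots, forcing `s_α w = w`.
  obtain ⟨w, a, ha, rfl⟩ := exists_smul_mem_support b α
  obtain ⟨u, hu, e⟩ := exists_map_borel_of_mem_compactWeyl hθ hH hmem b w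
  have heq := eq_of_map_borel_eq h𝔰 hθ hH hu e.symm fun β hβ => by
    rw [reflW_conj, inv_mul_cancel_right, mul_inv_rev, reflW_inv, mul_smul, isPos_reflW_iff ha]
    · rintro h
      apply hα
      rwa [← h, smul_inv_smul]
    · rintro h
      have h3 : β = reflW (IsKilling.rootSystem H) (w • a) • (w • a) := by
        rw [← smul_neg, ← h, smul_inv_smul]
      have h4 := hcl _ hβ _ hβ
      rw [h3, reflW_neg, reflW_smul_cancel] at h4
      exact hα h4
  have h5 : reflW (IsKilling.rootSystem H) (w • a) = 1 := by
    exact mul_eq_right.mp heq.symm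
  have h6 := isPos_neg b (w • a)
  rw [h5, one_smul] at h6
  tauto

end Conjugacy

/-! ### Comparing the Bruhat orders of a subsystem and of all roots -/

section Midpoints

variable {ι R M N : Type*} [Field R] [CharZero R] [AddCommGroup M] [Module R M]
  [AddCommGroup N] [Module R N] {P : RootPairing ι R M N} [P.IsCrystallographic] [P.IsReduced]
  {b : P.Base} {Ψ : Set ι} [Finite ι]

/-- An element which is a midpoint for both Bruhat orders has a counterpart of the same kind. -/
theorem exists_other_midpoint (hΨ : IsReflClosed P Ψ) {x z m : P.weylGroup}
    (hm : m ∈ between b Set.univ x z) (hmΨ : m ∈ between b Ψ x z) :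
    ∃ m', m' ≠ m ∧ (∃ γ ∈ Ψ, m' = reflW P γ * z) ∧ (∃ δ ∈ Ψ, x = reflW P δ * m') ∧
      m' ∈ between b Set.univ x z ∧ invCount b Ψ m' = invCount b Ψ z + 1 := by
  have hc := between_invCount hm
  obtain ⟨m', hm', hne⟩ := Set.exists_ne_of_one_lt_ncard
    (by rw [ncard_between hΨ hmΨ]; exact Nat.one_lt_two) m
  obtain ⟨⟨δ, hδ, hpδ, hx, h1⟩, ⟨γ, hγ, hpγ, hz, h2⟩⟩ := hm'
  -- Whether a positive reflection raises the count depends only on the sign of the inverse image of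
  -- its root, which is the same test for `Ψ` and for all roots. Strict inequalities and a total gap
  -- of two then leave steps of one.
  have hl1 : invCount b Set.univ m' < invCount b Set.univ x := by
    rw [hx]
    exact invCount_lt isReflClosed_univ (Set.mem_univ _) hpδ
      ((isPos_inv_smul_iff hΨ hδ hpδ).mpr (by rw [← hx]; omega))
  have hl2 : invCount b Set.univ z < invCount b Set.univ m' := by
    rw [hz]
    exact invCount_lt isReflClosed_univ (Set.mem_univ _) hpγ
      ((isPos_inv_smul_iff hΨ hγ hpγ).mpr (by rw [← hz]; omega))
  exact ⟨m', hne, ⟨γ, hγ, hz⟩, ⟨δ, hδ, hx⟩,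
    ⟨Cover.of_eq isReflClosed_univ (Set.mem_univ δ) hx (by omega),
      Cover.of_eq isReflClosed_univ (Set.mem_univ γ) hz (by omega)⟩, h2⟩

end Midpoints

/-! ### The Bruhat order of `W`, and weights in translates of the chamber -/

section Bruhat

variable {𝔰 : Type*} [LieRing 𝔰] [LieAlgebra ℂ 𝔰] [FiniteDimensional ℂ 𝔰]
  [LieAlgebra.IsKilling ℂ 𝔰] {H : LieSubalgebra ℂ 𝔰} [H.IsCartanSubalgebra]
  {b : (IsKilling.rootSystem H).Base}

theorem length_eq_invCount (w : Weyl H) : length b w = invCount b Set.univ w :=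
  sInf_word_length w

theorem arrow_iff_cover {x y : Weyl H} : Arrow b x y ↔ Cover b Set.univ x y := by
  rw [Arrow, length_eq_invCount, length_eq_invCount]
  constructor
  · rintro ⟨⟨α, h⟩, hc⟩
    exact Cover.of_eq isReflClosed_univ (Set.mem_univ α) h hc
  · rintro ⟨d, -, -, h, hc⟩
    exact ⟨⟨d, h⟩, hc⟩

theorem BruhatLT.length_lt {x y : Weyl H} (h : BruhatLT b x y) : length b y < length b x := by
  induction h with
  | single h => rw [h.2]; exact Nat.lt_succ_self _
  | tail _ h ih => have := h.2; omega

theorem BruhatLT.arrow {x y : Weyl H} (h : BruhatLT b x y) (hl : length b x = length b y + 1) :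
    Arrow b x y := by
  rcases h with h | ⟨h, h'⟩
  · exact h
  · have h1 := BruhatLT.length_lt h
    have h2 := h'.2
    omega

theorem bruhat_between_eq {x z : Weyl H} (hl : length b x = length b z + 2) :
    {w | BruhatLT b x w ∧ BruhatLT b w z} = between b Set.univ x z := by
  ext w
  constructor
  · rintro ⟨h1, h2⟩
    have l1 := h1.length_lt
    have l2 := h2.length_lt
    exact ⟨arrow_iff_cover.mp (h1.arrow (by omega)), arrow_iff_cover.mp (h2.arrow (by omega))⟩
  · rintro ⟨h1, h2⟩
    exact ⟨.single (arrow_iff_cover.mpr h1), .single (arrow_iff_cover.mpr h2)⟩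

variable {μ : Dual ℂ H}

theorem apply_coroot_neg (μ : Dual ℂ H) (β : H.root) :
    μ ((IsKilling.rootSystem H).coroot (reflW (IsKilling.rootSystem H) β • β)) =
      -μ ((IsKilling.rootSystem H).coroot β) := by
  rw [reflW_smul, RootPairing.coroot_reflectionPerm, RootPairing.coreflection_apply_self, map_neg]

theorem apply_coroot_of_mem_closedChamber {ν : Dual ℂ H} (hν : ν ∈ closedChamber b) {w : Weyl H}
    (hw : μ = w • ν) {β : H.root} (hβ : b.IsPos (w⁻¹ • β)) :
    0 ≤ (μ ((IsKilling.rootSystem H).coroot β)).re ∧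
      (μ ((IsKilling.rootSystem H).coroot β)).im = 0 := by
  have h := toLinearMap_smul_coroot w ν (w⁻¹ • β)
  rw [smul_inv_smul, ← hw] at h
  have h' : μ ((IsKilling.rootSystem H).coroot β) =
    ν ((IsKilling.rootSystem H).coroot (w⁻¹ • β)) := h
  rw [h']
  exact hν _ hβ

/-- A weight which is dominant for both `z` and `s_β z` is orthogonal to `β`. -/
theorem apply_coroot_eq_zero {ν ν' : Dual ℂ H} (hν : ν ∈ closedChamber b)
    (hν' : ν' ∈ closedChamber b) {z : Weyl H} {β : H.root} (hz : μ = z • ν)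
    (hx : μ = (reflW (IsKilling.rootSystem H) β * z) • ν') :
    μ ((IsKilling.rootSystem H).coroot β) = 0 := by
  by_cases hp : b.IsPos (z⁻¹ • β)
  · have h1 := apply_coroot_of_mem_closedChamber hν hz hp
    have h2 := apply_coroot_of_mem_closedChamber hν' hx
      (β := reflW (IsKilling.rootSystem H) β • β)
      (by rwa [reflW_mul_inv_smul, reflW_smul_cancel])
    rw [apply_coroot_neg, Complex.neg_re] at h2
    exact Complex.ext (le_antisymm (neg_nonneg.mp h2.1) h1.1) h1.2
  · have h1 := apply_coroot_of_mem_closedChamber hν hz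
      (β := reflW (IsKilling.rootSystem H) β • β) (by rwa [isPos_smul_neg])
    have h2 := apply_coroot_of_mem_closedChamber hν' hx (β := β)
      (by rwa [reflW_mul_inv_smul, isPos_smul_neg])
    rw [apply_coroot_neg, Complex.neg_re] at h1
    exact Complex.ext (le_antisymm (neg_nonneg.mp h1.1) h2.1) h2.2

theorem reflW_smul_eq_sub (β : H.root) (μ : Dual ℂ H) : reflW (IsKilling.rootSystem H) β • μ =
    μ - μ ((IsKilling.rootSystem H).coroot β) • (IsKilling.rootSystem H).root β := rfl

theorem reflW_smul_eq_self {β : H.root} (h : μ ((IsKilling.rootSystem H).coroot β) = 0) :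
    reflW (IsKilling.rootSystem H) β • μ = μ := by
  rw [reflW_smul_eq_sub, h, zero_smul, sub_zero]

/-- From `s_γ μ = s_δ μ` the multiples of `γ` and `δ` subtracted from `μ` agree. If they are
nonzero, the roots are proportional, hence equal up to sign, and the reflections coincide. -/
theorem apply_coroot_eq_zero_of_mul_smul {γ δ : H.root}
    (h : (reflW (IsKilling.rootSystem H) δ * reflW (IsKilling.rootSystem H) γ) • μ = μ)
    (hne : reflW (IsKilling.rootSystem H) δ * reflW (IsKilling.rootSystem H) γ ≠ 1) :
    μ ((IsKilling.rootSystem H).coroot γ) = 0 := by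
  by_contra h0
  have h1 : reflW (IsKilling.rootSystem H) γ • μ = reflW (IsKilling.rootSystem H) δ • μ := by
    rw [← reflW_inv δ, eq_inv_smul_iff, smul_smul, h]
  rw [reflW_smul_eq_sub, reflW_smul_eq_sub, sub_right_inj] at h1
  have hdep : ¬ LinearIndependent ℂ
      ![(IsKilling.rootSystem H).root γ, (IsKilling.rootSystem H).root δ] := fun hli => by
    refine h0 (LinearIndependent.pair_iff.mp hli _
      (-μ ((IsKilling.rootSystem H).coroot δ)) ?_).1
    rw [h1, neg_smul, add_neg_cancel]
  by_cases he : γ = δ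
  · exact hne (by rw [he, reflW_mul_self])
  · have h2 := RootPairing.IsReduced.eq_or_eq_neg γ δ hdep
    rcases h2 with h2 | h2
    · exact he ((IsKilling.rootSystem H).root.injective h2)
    · have h3 : γ = reflW (IsKilling.rootSystem H) δ • δ :=
        (IsKilling.rootSystem H).root.injective (by rw [h2, root_reflW_self])
      exact hne (by rw [h3, reflW_neg, reflW_mul_self])

theorem apply_coroot_eq_zero_of_mul_eq {γ δ γ' δ' : H.root} {z : Weyl H}
    (hδ : μ ((IsKilling.rootSystem H).coroot δ) = 0)
    (hγ : μ ((IsKilling.rootSystem H).coroot γ) = 0)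
    (h : reflW (IsKilling.rootSystem H) δ * (reflW (IsKilling.rootSystem H) γ * z) =
      reflW (IsKilling.rootSystem H) δ' * (reflW (IsKilling.rootSystem H) γ' * z))
    (hne : reflW (IsKilling.rootSystem H) δ * (reflW (IsKilling.rootSystem H) γ * z) ≠ z) :
    μ ((IsKilling.rootSystem H).coroot γ') = 0 := by
  have hmul : reflW (IsKilling.rootSystem H) δ * reflW (IsKilling.rootSystem H) γ =
      reflW (IsKilling.rootSystem H) δ' * reflW (IsKilling.rootSystem H) γ' :=
    mul_right_cancel (b := z) (by rw [mul_assoc, mul_assoc, h])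
  refine apply_coroot_eq_zero_of_mul_smul (δ := δ') ?_ ?_
  · rw [← hmul, mul_smul, reflW_smul_eq_self hγ, reflW_smul_eq_self hδ]
  · intro h1
    exact hne (by rw [← mul_assoc, hmul, h1, one_mul])

end Bruhat

/-! ### Condition (⋆) and the differential, deduced from completed squares -/

section Complex

variable {𝔰 : Type*} [LieRing 𝔰] [LieAlgebra ℂ 𝔰] [FiniteDimensional ℂ 𝔰]
  [LieAlgebra.IsKilling ℂ 𝔰] {H : LieSubalgebra ℂ 𝔰} [H.IsCartanSubalgebra]
  {b : (IsKilling.rootSystem H).Base} {V : Set (Weyl H)}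

/-- Every two-step path in `V` can be completed to a square in `V`. -/
def HasSquares (b : (IsKilling.rootSystem H).Base) (V : Set (Weyl H)) : Prop :=
  ∀ x ∈ V, ∀ z ∈ V, ∀ m ∈ V, m ∈ between b Set.univ x z →
    ∃ m' ∈ V, m' ≠ m ∧ between b Set.univ x z = {m, m'}

theorem HasSquares.star (h : HasSquares b V) : Star b V := by
  intro x hx z hz hl
  have he : {w ∈ V | BruhatLT b x w ∧ BruhatLT b w z} = V ∩ between b Set.univ x z := by
    rw [← bruhat_between_eq hl]; rfl
  rw [he]
  rcases (V ∩ between b Set.univ x z).eq_empty_or_nonempty with h0 | ⟨m, hmV, hm⟩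
  · exact Or.inl h0
  · obtain ⟨m', hm'V, hne, heq⟩ := h x hx z hz m hmV hm
    right
    rw [Set.inter_eq_right.mpr, heq, Set.ncard_pair hne.symm]
    rw [heq]
    rintro w (hw | hw)
    · exact hw.symm ▸ hmV
    · exact Set.mem_singleton_iff.mp hw ▸ hm'V

/-- Squares in `V` are squares of the full Bruhat graph, so its signs can be restricted to any `V`.
-/
theorem exists_isCoeff (b : (IsKilling.rootSystem H).Base) (V : Set (Weyl H)) :
    ∃ s : V → V → ℂ, IsCoeff b V s := by
  classical
  obtain ⟨E, hE⟩ := exists_sign (P := IsKilling.rootSystem H) (b := b) isReflClosed_univ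
  refine ⟨fun x y => if Arrow b y.1 x.1 then ((E y x : ℤ) : ℂ) else 0, ⟨?_, ?_, ?_⟩⟩
  · intro x y h
    rw [if_pos h]
    rcases Int.units_eq_one_or (E y x) with h | h <;> simp [h]
  · intro x y h
    rw [if_neg h]
  · intro x w w' y hne h1 h2 h3 h4
    rw [if_pos h1, if_pos h2, if_pos h3, if_pos h4]
    have := hE y w w' x (fun h => hne (Subtype.ext h))
      ⟨arrow_iff_cover.mp h2, arrow_iff_cover.mp h1⟩ ⟨arrow_iff_cover.mp h4, arrow_iff_cover.mp h3⟩
    have hu : ∀ a b c d : ℤˣ, a * b * (c * d) = -1 → (b * a : ℤ) + d * c = 0 := by decide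
    exact_mod_cast hu _ _ _ _ this

theorem mem_cochains {q : ℤ} {f : V →₀ ℂ} (h : ∀ v, f v ≠ 0 → (length b v.1 : ℤ) = q) :
    f ∈ cochains b V q := by
  rw [← f.sum_single]
  refine Submodule.sum_mem _ fun v hv => ?_
  have : Finsupp.single v (f v) = f v • Finsupp.single v (1 : ℂ) := by
    rw [Finsupp.smul_single, smul_eq_mul, mul_one]
  rw [this]
  exact Submodule.smul_mem _ _ (Submodule.subset_span ⟨v, h v (Finsupp.mem_support_iff.mp hv), rfl⟩)

theorem differential_single (s : V → V → ℂ) (x : V) :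
    differential V s (Finsupp.single x 1) = Finsupp.equivFunOnFinite.symm (s x) := by
  rw [differential, Finsupp.linearCombination_single, one_smul]

theorem differential_apply [Fintype V] (s : V → V → ℂ) (f : V →₀ ℂ) (y : V) :
    differential V s f y = ∑ w, f w * s w y := by
  rw [differential, Finsupp.linearCombination_apply, Finsupp.sum_fintype _ _ (by simp),
    Finsupp.finsetSum_apply]
  rfl

theorem IsCoeff.differential_mem {s : V → V → ℂ} (hs : IsCoeff b V s) {q : ℤ} {f : V →₀ ℂ}
    (hf : f ∈ cochains b V q) : differential V s f ∈ cochains b V (q + 1) := by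
  have h : cochains b V q ≤ (cochains b V (q + 1)).comap (differential V s) := by
    refine Submodule.span_le.mpr ?_
    rintro - ⟨v, hv, rfl⟩
    change differential V s _ ∈ cochains b V (q + 1)
    rw [differential_single]
    refine mem_cochains fun y hy => ?_
    have ha : Arrow b y.1 v.1 := by
      by_contra hn
      exact hy (hs.non_edge v y hn)
    rw [ha.2, ← hv]
    push_cast
    rfl
  exact h hf

/-- An entry of `d²` is a sum over midpoints in `V`: there are none, or exactly the two of one
square. -/
theorem IsCoeff.differential_comp {s : V → V → ℂ} (hs : IsCoeff b V s) (hV : HasSquares b V) :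
    differential V s ∘ₗ differential V s = 0 := by
  classical
  have := Fintype.ofFinite V
  have hne : ∀ x m y : V, s x m * s m y ≠ 0 → Arrow b m.1 x.1 ∧ Arrow b y.1 m.1 := by
    intro x m y h
    constructor
    · by_contra hn
      exact h (by rw [hs.non_edge x m hn, zero_mul])
    · by_contra hn
      exact h (by rw [hs.non_edge m y hn, mul_zero])
  refine Finsupp.lhom_ext' fun x => LinearMap.ext_ring (Finsupp.ext fun y => ?_)
  change differential V s (differential V s (Finsupp.single x 1)) y = 0
  rw [differential_single, differential_apply]
  change ∑ w, s x w * s w y = 0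
  by_cases h0 : ∀ m, s x m * s m y = 0
  · exact Finset.sum_eq_zero fun m _ => h0 m
  · obtain ⟨m, hm⟩ := not_forall.mp h0
    obtain ⟨h1, h2⟩ := hne _ _ _ hm
    obtain ⟨m', hm', hmm', heq⟩ := hV y y.2 x x.2 m m.2
      ⟨arrow_iff_cover.mp h2, arrow_iff_cover.mp h1⟩
    have hb : m' ∈ between b Set.univ y.1 x.1 := by rw [heq]; simp
    have hne' : m ≠ ⟨m', hm'⟩ := fun h => hmm' (congrArg Subtype.val h).symm
    rw [Fintype.sum_eq_add m ⟨m', hm'⟩ hne']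
    · exact hs.square x m ⟨m', hm'⟩ y hne' h1 h2 (arrow_iff_cover.mpr hb.2)
        (arrow_iff_cover.mpr hb.1)
    · rintro w ⟨hw1, hw2⟩
      by_contra hw
      obtain ⟨h3, h4⟩ := hne _ _ _ hw
      have hwb : w.1 ∈ between b Set.univ y.1 x.1 :=
        ⟨arrow_iff_cover.mp h4, arrow_iff_cover.mp h3⟩
      rw [heq] at hwb
      rcases hwb with h5 | h5
      · exact hw1 (Subtype.ext h5)
      · exact hw2 (Subtype.ext h5)

end Complex

/-! ### Completing squares in `𝒱` -/

section Squares

variable {𝔤 : Type*} [LieRing 𝔤] [LieAlgebra ℂ 𝔤] [FiniteDimensional ℂ 𝔤]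
  {𝔰 : LieIdeal ℂ 𝔤} [LieAlgebra.IsKilling ℂ 𝔰] {H : LieSubalgebra ℂ 𝔰} [H.IsCartanSubalgebra]
  {θ : 𝔤 ≃ₗ⁅ℂ⁆ 𝔤} {b : (IsKilling.rootSystem H).Base}

theorem compactLength_eq_invCount (w : Weyl H) :
    compactLength b θ w = invCount b {α : H.root | IsCompactRoot θ α} w := by
  rw [compactLength, invCount]
  congr 1
  ext α
  constructor
  · rintro ⟨h1, ⟨β, h2, rfl⟩, h3⟩
    exact ⟨h3, h1, by rwa [inv_smul_smul]⟩
  · rintro ⟨h3, h1, h2⟩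
    exact ⟨h1, ⟨w⁻¹ • α, h2, (smul_inv_smul w α).symm⟩, h3⟩

theorem reflW_mul_mem_setA (hθ : ∀ x, θ (θ x) = x)
    (hH : cartan 𝔰 H ≤ (fixedSubalgebra θ).toSubmodule)
    {Q : Set (Submodule ℂ 𝔤)} (hQ : IsOrbit θ Q) {y : Weyl H} (hy : y ∈ setA b Q)
    {δ : H.root} (hδ : IsCompactRoot θ δ) :
    reflW (IsKilling.rootSystem H) δ * y ∈ setA b Q := by
  obtain ⟨B, -, rfl⟩ := hQ
  obtain ⟨u, hu, e⟩ := hy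
  obtain ⟨v, hv, -, h⟩ := exists_map_borel hθ hH hδ
  refine ⟨v * u, mul_mem hv hu, ?_⟩
  rw [← h, e, ← Submodule.map_comp]
  rfl

theorem reflW_mul_mem_setD {lam : Dual ℂ (cartan 𝔰 H)} {y : Weyl H} (hy : y ∈ setD b lam)
    {δ : H.root}
    (hδ : (lam ∘ₗ toCartan 𝔰 H + rho b) ((IsKilling.rootSystem H).coroot δ) = 0) :
    reflW (IsKilling.rootSystem H) δ * y ∈ setD b lam := by
  obtain ⟨ν, hν, h⟩ := hy
  refine ⟨ν, hν, ?_⟩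
  rw [mul_smul, ← h, reflW_smul_eq_self hδ]

theorem hasSquares_setV (h𝔰 : IsCompl 𝔰 (LieAlgebra.center ℂ 𝔤)) (hθ : ∀ x, θ (θ x) = x)
    (hH : cartan 𝔰 H ≤ (fixedSubalgebra θ).toSubmodule)
    {Q : Set (Submodule ℂ 𝔤)} (hQ : IsOrbit θ Q) (lam : Dual ℂ (cartan 𝔰 H)) (c : ℤ) :
    HasSquares b (setV b θ (setA b Q) (setD b lam) c) := by
  rintro x ⟨⟨hxA, hxD⟩, hxl⟩ z ⟨⟨hzA, hzD⟩, hzl⟩ m ⟨⟨hmA, hmD⟩, hml⟩ hm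
  have hcl := isReflClosed_compact hθ hH
  rw [length_eq_invCount, compactLength_eq_invCount] at hxl hzl hml
  have hcard := ncard_between isReflClosed_univ hm
  obtain ⟨⟨δ, -, -, rfl, hc1⟩, ⟨γ, -, -, rfl, hc2⟩⟩ := id hm
  set μ := lam ∘ₗ toCartan 𝔰 H + rho b with hμ
  have hδ : IsCompactRoot θ δ := isCompactRoot_of_mem_setA h𝔰 hθ hH hQ hxA hmA
  have hγ : IsCompactRoot θ γ := isCompactRoot_of_mem_setA h𝔰 hθ hH hQ hmA hzA
  have hμδ : μ ((IsKilling.rootSystem H).coroot δ) = 0 := by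
    obtain ⟨ν, hν, h⟩ := hmD
    obtain ⟨ν', hν', h'⟩ := hxD
    exact apply_coroot_eq_zero hν hν' h h'
  have hμγ : μ ((IsKilling.rootSystem H).coroot γ) = 0 := by
    obtain ⟨ν, hν, h⟩ := hzD
    obtain ⟨ν', hν', h'⟩ := hmD
    exact apply_coroot_eq_zero hν hν' h h'
  -- On `𝒱` the lengths `l` and `l_K` differ by the constant `c`, so steps of one in `l` are steps
  -- of one in `l_K`.
  have hmK : reflW (IsKilling.rootSystem H) γ * z ∈ between b {α : H.root | IsCompactRoot θ α}
      (reflW (IsKilling.rootSystem H) δ * (reflW (IsKilling.rootSystem H) γ * z)) z :=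
    ⟨Cover.of_eq hcl hδ rfl (by omega), Cover.of_eq hcl hγ rfl (by omega)⟩
  obtain ⟨m', hne, ⟨γ', hγ', rfl⟩, ⟨δ', -, hx'⟩, hm', hcount⟩ := exists_other_midpoint hcl hm hmK
  -- The new path has the same total displacement `s_δ s_γ`, which fixes `μ`; it is not the identity
  -- because `x` and `z` have different lengths.
  have hμγ' : μ ((IsKilling.rootSystem H).coroot γ') = 0 :=
    apply_coroot_eq_zero_of_mul_eq hμδ hμγ hx' fun h1 => by
      rw [h1] at hc1
      omega
  refine ⟨reflW (IsKilling.rootSystem H) γ' * z, ⟨⟨reflW_mul_mem_setA hθ hH hQ hzA hγ',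
    reflW_mul_mem_setD hzD hμγ'⟩, ?_⟩, hne, ?_⟩
  · rw [length_eq_invCount, compactLength_eq_invCount, hm'.2.invCount_eq, hcount]
    omega
  · symm
    refine Set.eq_of_subset_of_ncard_le ?_ ?_
    · rintro w (hw | hw)
      · exact hw.symm ▸ hm
      · exact (Set.mem_singleton_iff.mp hw).symm ▸ hm'
    · rw [hcard, Set.ncard_pair hne.symm]

end Squares

end CompactWeyl

theorem mainTheorem5
    {𝔤 : Type*} [LieRing 𝔤] [LieAlgebra ℂ 𝔤] [FiniteDimensional ℂ 𝔤]
    (𝔰 : LieIdeal ℂ 𝔤) [LieAlgebra.IsSemisimple ℂ 𝔰]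
    (h𝔰 : IsCompl 𝔰 (LieAlgebra.center ℂ 𝔤))
    (H : LieSubalgebra ℂ 𝔰) [H.IsCartanSubalgebra]
    (b : (LieAlgebra.IsKilling.rootSystem H).Base)
    (θ : 𝔤 ≃ₗ⁅ℂ⁆ 𝔤) (hθ : ∀ x, θ (θ x) = x)
    (hH : CompactWeyl.cartan 𝔰 H ≤ (CompactWeyl.fixedSubalgebra θ).toSubmodule)
    (Q : Set (Submodule ℂ 𝔤)) (hQ : CompactWeyl.IsOrbit θ Q)
    (lam : Module.Dual ℂ (CompactWeyl.cartan 𝔰 H)) (c : ℤ)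
    (V : Set (CompactWeyl.Weyl H))
    (hV : V = CompactWeyl.setV b θ (CompactWeyl.setA b Q) (CompactWeyl.setD b lam) c) :
    CompactWeyl.Star b V ∧
    (∃ s : V → V → ℂ, CompactWeyl.IsCoeff b V s) ∧
    (∀ s : V → V → ℂ, CompactWeyl.IsCoeff b V s →
      (∀ q : ℤ, ∀ f ∈ CompactWeyl.cochains b V q,
        CompactWeyl.differential V s f ∈ CompactWeyl.cochains b V (q + 1)) ∧
      CompactWeyl.differential V s ∘ₗ CompactWeyl.differential V s = 0) := by
  subst hV
  have h := CompactWeyl.hasSquares_setV (b := b) h𝔰 hθ hH hQ lam c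
  exact ⟨h.star, CompactWeyl.exists_isCoeff b _, fun s hs =>
    ⟨fun q f hf => hs.differential_mem hf, hs.differential_comp h⟩⟩
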